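/- Let $f:\mathbb N\to\mathbb N$ be a non-decreasing computable function. For sets $X,Y\subseteq\mathbb N$ (identified with their characteristic sequences), say that $X$ is computable by $Y$ with oracle-use bounded above by $f$ if there is an oracle program which with oracle $Y$ computes the characteristic function of $X$ and which, for every $n$, in the computation of $X(n)$ queries only digits among the first $f(n)$ digits $Y(0),\dots,Y(f(n)-1)$ of $Y$. Let $U$ be any universal prefix-free machine, that is, a partial computable function from binary strings to binary strings with prefix-free domain such that for every partial computable function $M$ on binary strings with prefix-free domain there is a constant $d$ such that whenever $M(\sigma)=x$ there is $\tau$ with $U(\tau)=x$ and $|\tau|\le|\sigma|+d$. Let $\Omega=\Omega_U=\sum_{U(\sigma)\downarrow}2^{-|\sigma|}$ be its halting probability, identified with the sequence of digits of its binary expansion. Then the following are equivalent: (a) $\sum_{n}2^{-f(n)}<\infty$; (b) every computably enumerable set $X$ is computable by $\Omega$ with oracle-use bounded above by $f$; (c) every computably enumerable set $X$ is computable by some set $Y$ with oracle-use bounded above by $f$. (The equivalence of (a) and (c), which does not mention $U$, is also asserted on its own.) -/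

import Mathlib

/-- The characteristic function of a set of natural numbers. -/
noncomputable def charFn (X : Set ℕ) : ℕ → ℕ := X.indicator fun _ => 1

/-- Oracle programs: the usual codes for partial recursive functions, with the oracle as an
additional basic instruction. -/
inductive OracleCode : Type
  | zero : OracleCode
  | succ : OracleCode
  | left : OracleCode
  | right : OracleCode
  | oracle : OracleCode
  | pair : OracleCode → OracleCode → OracleCode
  | comp : OracleCode → OracleCode → OracleCode
  | prec : OracleCode → OracleCode → OracleCode
  | rfind : OracleCode → OracleCode

/-- `OracleCode.Run Y c n v Q`: with oracle `Y`, the program `c` halts on input `n` with output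
`v`, and `Q` is the set of all positions of `Y` that are queried during this computation.
`prec a b` is primitive recursion, and `rfind a` on input `⟨n, m⟩` searches for the least `k ≥ m`
with `a ⟨n, k⟩ = 0`. -/
inductive OracleCode.Run (Y : Set ℕ) : OracleCode → ℕ → ℕ → Finset ℕ → Prop
  | zero (n : ℕ) : Run Y .zero n 0 ∅
  | succ (n : ℕ) : Run Y .succ n (n + 1) ∅
  | left (n : ℕ) : Run Y .left n n.unpair.1 ∅
  | right (n : ℕ) : Run Y .right n n.unpair.2 ∅
  | oracle (n : ℕ) : Run Y .oracle n (charFn Y n) {n}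
  | pair {a b : OracleCode} {n x y : ℕ} {Q R : Finset ℕ} :
      Run Y a n x Q → Run Y b n y R → Run Y (.pair a b) n (Nat.pair x y) (Q ∪ R)
  | comp {a b : OracleCode} {n x y : ℕ} {Q R : Finset ℕ} :
      Run Y b n x Q → Run Y a x y R → Run Y (.comp a b) n y (Q ∪ R)
  | prec_zero {a b : OracleCode} {n x : ℕ} {Q : Finset ℕ} :
      Run Y a n x Q → Run Y (.prec a b) (Nat.pair n 0) x Q
  | prec_succ {a b : OracleCode} {n k i x : ℕ} {Q R : Finset ℕ} :
      Run Y (.prec a b) (Nat.pair n k) i Q →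
      Run Y b (Nat.pair n (Nat.pair k i)) x R →
      Run Y (.prec a b) (Nat.pair n (k + 1)) x (Q ∪ R)
  | rfind_stop {a : OracleCode} {n m : ℕ} {Q : Finset ℕ} :
      Run Y a (Nat.pair n m) 0 Q → Run Y (.rfind a) (Nat.pair n m) m Q
  | rfind_next {a : OracleCode} {n m k x : ℕ} {Q R : Finset ℕ} :
      Run Y a (Nat.pair n m) (k + 1) Q →
      Run Y (.rfind a) (Nat.pair n (m + 1)) x R →
      Run Y (.rfind a) (Nat.pair n m) x (Q ∪ R)

/-- `X` is computable by `Y` with oracle-use bounded above by `f`: some oracle program with oracle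
`Y` computes `X`, and for every `n` its computation of `X(n)` queries only digits among the first
`f n` digits of `Y`. -/
def ComputableWithUse (X Y : Set ℕ) (f : ℕ → ℕ) : Prop :=
  ∃ c : OracleCode, ∀ n : ℕ, ∃ Q : Finset ℕ,
    OracleCode.Run Y c n (charFn X n) Q ∧ ∀ q ∈ Q, q < f n

/-- A prefix-free machine: a partial computable function on binary strings whose domain contains
no two distinct strings one of which is a prefix of the other. -/
structure IsPrefixFreeMachine (M : List Bool →. List Bool) : Prop where
  partrec : Partrec M
  prefix_free : ∀ σ τ : List Bool, (M σ).Dom → (M τ).Dom → σ <+: τ → σ = τ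

/-- A universal prefix-free machine: one that simulates every prefix-free machine `M`, with
descriptions that are longer by at most a constant depending on `M`. -/
structure IsUniversalPrefixFreeMachine (U : List Bool →. List Bool) : Prop where
  isPrefixFreeMachine : IsPrefixFreeMachine U
  universal : ∀ M : List Bool →. List Bool, IsPrefixFreeMachine M →
    ∃ d : ℕ, ∀ σ x : List Bool, x ∈ M σ →
      ∃ τ : List Bool, x ∈ U τ ∧ τ.length ≤ σ.length + d

/-- The halting probability of a prefix-free machine (the series converges, with sum at most `1`,
by Kraft's inequality). -/
noncomputable def haltingProbability (U : List Bool →. List Bool) : ℝ :=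
  ∑' σ : {σ : List Bool // (U σ).Dom}, ((2 : ℝ) ^ σ.1.length)⁻¹

/-- A real in `[0, 1)`, as the set of the positions (counted from `0`) of the ones in its binary
expansion. -/
noncomputable def binaryExpansion (x : ℝ) : Set ℕ := {n | Real.digits x 2 n = 1}

/-!
Let `f` be a computable non-decreasing function.

*Convergence is necessary.* If all computably enumerable sets can be computed with use `f`, then in
particular `diagonalSet f` can. An oracle program acts on finite oracles as a partial recursive
function (`OracleCode.exists_partrec_of_finite_oracle`), say the `e`-th one, and the residue class
of the numbers `n₀ < n₁ < …` with `nᵢ = classElem e i` is devoted to it. The number `nₘ` is put into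
the set once strings `σ₀, …, σₘ` are found such that `σᵢ` has length `f nᵢ`, predicts, as an oracle,
that `nᵢ` is not in the set, and extends none of the earlier strings. No initial segment of a
correct oracle is among strings found for numbers in the set; so whenever `n₀, …, nₘ₋₁` are in the
set, the correct oracle supplies a further string, unless `nₘ` is in the set anyway. Therefore all
the `nₘ` enter the set. The strings found for `nₘ` are pairwise incompatible, because the later ones
are not shorter, `f` being monotone, and do not extend the earlier ones. So `∑ᵢ 2 ^ (-f nᵢ) ≤ 1` by
Kraft's inequality, and by monotonicity the sum over one residue class converges only if the sum
over all `n` does (`summable_of_computableWithUse_diagonalSet`).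

*Convergence suffices.* Let `X` be computably enumerable, and let `y` be the limit of a computable
increasing sequence of dyadic rationals `y t`. If for almost all `n` the limit `y` exceeds `y t` by
at least `2 ^ (-f n)` whenever `n` is enumerated after stage `t`, then the first `f n` digits of `y`
determine whether `n ∈ X`: one looks for a stage `t` at which `y t` has the same first `f n` digits,
and for almost all `n` no later enumeration of `n` is possible
(`computableWithUse_of_approximation`). For some oracle, without reference to a universal machine,
it is enough to sum `2 ^ (-f n)` over almost all `n ∈ X`
(`exists_computableWithUse_of_summable`).

For `y = Ω` the required property is a form of Solovay randomness. The universal machine has to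
react when another prefix-free machine produces strings that are longer than all its outputs so far.
Hence, up to constant factors, no computable bounded increasing sequence of dyadic rationals
converges more slowly than the approximations `Ω s` to `Ω`
(`IsUniversalPrefixFreeMachine.exists_isSlowestApproximation`). Now suppose that infinitely many
intervals `[Ω (t i), Ω (t i) + 2 ^ (-k i)]` contain `Ω`, where `∑ 2 ^ (-k i)` converges and `t`, `k`
are computable. The sequence whose `s`-th term is the total length of the parts of the first `s`
intervals that lie to the left of `Ω s` is bounded and increasing; but once `M` of the intervals
that contain `Ω` have appeared, it has at least `M` times the distance from `Ω s` to `Ω` to go. For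
large `M` this is a contradiction (`IsSlowestApproximation.exists_forall_add_lt`). The same property
shows that `Ω` is not a dyadic rational, so that its digits are the limits of the digits of `Ω s`.
-/

/-! ### Computable functions and enumerations -/

namespace Computable

variable {α : Type*} [Primcodable α]

theorem nat_add {f g : α → ℕ} (hf : Computable f) (hg : Computable g) :
    Computable fun a => f a + g a :=
  Primrec.nat_add.to_comp.comp hf hg

theorem nat_mul {f g : α → ℕ} (hf : Computable f) (hg : Computable g) :
    Computable fun a => f a * g a :=
  Primrec.nat_mul.to_comp.comp hf hg

theorem nat_sub {f g : α → ℕ} (hf : Computable f) (hg : Computable g) :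
    Computable fun a => f a - g a :=
  Primrec.nat_sub.to_comp.comp hf hg

theorem nat_div {f g : α → ℕ} (hf : Computable f) (hg : Computable g) :
    Computable fun a => f a / g a :=
  Primrec.nat_div.to_comp.comp hf hg

theorem nat_mod {f g : α → ℕ} (hf : Computable f) (hg : Computable g) :
    Computable fun a => f a % g a :=
  Primrec.nat_mod.to_comp.comp hf hg

theorem nat_min {f g : α → ℕ} (hf : Computable f) (hg : Computable g) :
    Computable fun a => min (f a) (g a) :=
  Primrec.nat_min.to_comp.comp hf hg

theorem two_pow {f : α → ℕ} (hf : Computable f) : Computable fun a => 2 ^ f a := by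
  have h : Computable₂ fun (_ : α) (p : ℕ × ℕ) => p.2 * 2 :=
    nat_mul (snd.comp snd) (const 2)
  refine (Computable.nat_rec hf (const 1) h).of_eq fun a => ?_
  induction f a with
  | zero => rfl
  | succ n ih => simp only [ih, pow_succ]

theorem sum_range {F : α → ℕ → ℕ} {g : α → ℕ} (hg : Computable g)
    (hF : Computable fun p : α × ℕ => F p.1 p.2) :
    Computable fun a => ∑ i ∈ Finset.range (g a), F a i := by
  have h : Computable₂ fun (a : α) (p : ℕ × ℕ) => p.2 + F a p.1 :=
    nat_add (snd.comp snd) (hF.comp (fst.pair (fst.comp snd)))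
  refine (Computable.nat_rec hg (const 0) h).of_eq fun a => ?_
  induction g a with
  | zero => rfl
  | succ n ih => simp only [ih, Finset.sum_range_succ]

theorem decide_eq {β : Type*} [Primcodable β] [DecidableEq β] {f g : α → β}
    (hf : Computable f) (hg : Computable g) : Computable fun a => decide (f a = g a) :=
  Primrec.eq.decide.to_comp.comp hf hg

theorem decide_lt {f g : α → ℕ} (hf : Computable f) (hg : Computable g) :
    Computable fun a => decide (f a < g a) :=
  Primrec.nat_lt.decide.to_comp.comp hf hg

theorem decide_le {f g : α → ℕ} (hf : Computable f) (hg : Computable g) :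
    Computable fun a => decide (f a ≤ g a) :=
  Primrec.nat_le.decide.to_comp.comp hf hg

theorem ite' {β : Type*} [Primcodable β] {p : α → Prop} [DecidablePred p] {f g : α → β}
    (hp : Computable fun a => decide (p a)) (hf : Computable f) (hg : Computable g) :
    Computable fun a => if p a then f a else g a :=
  (hp.cond hf hg).of_eq fun a => by by_cases h : p a <;> simp [h]

end Computable

theorem Computable.decide_and {α : Type*} [Primcodable α] {p q : α → Prop} [DecidablePred p]
    [DecidablePred q] (hp : Computable fun a => decide (p a))
    (hq : Computable fun a => decide (q a)) : Computable fun a => decide (p a ∧ q a) :=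
  (Primrec.and.to_comp.comp hp hq).of_eq fun a => by simp

theorem Computable.decide_not {α : Type*} [Primcodable α] {p : α → Prop} [DecidablePred p]
    (hp : Computable fun a => decide (p a)) : Computable fun a => decide (¬p a) :=
  (Primrec.not.to_comp.comp hp).of_eq fun a => by simp

theorem Computable.decide_forall_lt {α : Type*} [Primcodable α] {p : α → ℕ → Prop}
    [∀ a, DecidablePred (p a)] {g : α → ℕ} (hg : Computable g)
    (hp : Computable fun x : α × ℕ => decide (p x.1 x.2)) :
    Computable fun a => decide (∀ i < g a, p a i) := by
  have h : Computable fun a =>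
      decide (∑ i ∈ Finset.range (g a), (if p a i then 0 else 1) = 0) :=
    .decide_eq (.sum_range hg (.ite' hp (.const 0) (.const 1))) (.const 0)
  refine h.of_eq fun a => ?_
  simp [Finset.sum_eq_zero_iff]

theorem REPred.exists_of_computable {p : ℕ → ℕ → Prop} [∀ n, DecidablePred (p n)]
    (hp : Computable fun x : ℕ × ℕ => decide (p x.1 x.2)) : REPred fun n => ∃ w, p n w := by
  have h : Partrec fun n => Nat.rfind fun w => Part.some (decide (p n w)) :=
    Partrec.rfind hp.partrec
  exact h.dom_re.of_eq fun n => Nat.rfind_dom.trans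
    ⟨fun ⟨w, hw, _⟩ => ⟨w, by simpa using hw⟩,
      fun ⟨w, hw⟩ => ⟨w, by simpa using hw, fun _ => trivial⟩⟩

/-- A computably enumerable set can be enumerated without repetitions: `g i = n + 1` means that
`n` is enumerated at stage `i`, and `g i = 0` that nothing is. -/
theorem REPred.exists_enumeration {X : Set ℕ} (hX : REPred fun n => n ∈ X) :
    ∃ g : ℕ → ℕ, Computable g ∧ (∀ n, n ∈ X ↔ ∃ i, g i = n + 1) ∧
      ∀ i j, g i ≠ 0 → g i = g j → i = j := by
  have hX' : Partrec fun n => (Part.assert (n ∈ X) fun _ => Part.some ()).map fun _ => 0 :=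
    Partrec.map hX (Computable.const 0)
  obtain ⟨c, hc⟩ := Nat.Partrec.Code.exists_code.1 (Partrec.nat_iff.1 hX')
  have hdom : ∀ n, n ∈ X ↔ ∃ s, (Nat.Partrec.Code.evaln s c n).isSome := by
    intro n
    have h1 : n ∈ X ↔ ∃ v, v ∈ Nat.Partrec.Code.eval c n := by
      rw [hc]; simp
    rw [h1]
    simp only [Nat.Partrec.Code.evaln_complete, Option.isSome_iff_exists, Option.mem_def]
    exact exists_comm
  have hmono : ∀ n s t, s ≤ t → (Nat.Partrec.Code.evaln s c n).isSome →
      (Nat.Partrec.Code.evaln t c n).isSome := by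
    intro n s t hst h
    obtain ⟨v, hv⟩ := Option.isSome_iff_exists.1 h
    exact Option.isSome_iff_exists.2 ⟨v, Nat.Partrec.Code.evaln_mono hst hv⟩
  let p : ℕ → ℕ → Bool := fun n s => (Nat.Partrec.Code.evaln s c n).isSome
  have hp : Computable₂ p :=
    Primrec.option_isSome.to_comp.comp (Nat.Partrec.Code.primrec_evaln.to_comp.comp
      ((Computable.snd.pair (.const c)).pair .fst))
  let g : ℕ → ℕ := fun i =>
    bif p i.unpair.1 (i.unpair.2 + 1) && !p i.unpair.1 i.unpair.2 then i.unpair.1 + 1 else 0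
  have hu1 : Computable fun i : ℕ => i.unpair.1 := Computable.fst.comp .unpair
  have hu2 : Computable fun i : ℕ => i.unpair.2 := Computable.snd.comp .unpair
  have hg1 : ∀ i, g i ≠ 0 → g i = i.unpair.1 + 1 ∧ p i.unpair.1 (i.unpair.2 + 1) = true ∧
      p i.unpair.1 i.unpair.2 = false := by
    intro i hi
    cases h1 : p i.unpair.1 (i.unpair.2 + 1) <;> cases h2 : p i.unpair.1 i.unpair.2 <;>
      simp_all [g]
  refine ⟨g, .cond (Primrec.and.to_comp.comp (hp.comp hu1 (Computable.succ.comp hu2))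
    (Primrec.not.to_comp.comp (hp.comp hu1 hu2))) (Computable.succ.comp hu1) (.const 0), ?_, ?_⟩
  · refine fun n => ⟨fun hn => ?_, ?_⟩
    · have hex := (hdom n).1 hn
      have hpos : Nat.find hex ≠ 0 := by
        intro h0
        have := Nat.find_spec hex
        simp [h0, Nat.Partrec.Code.evaln] at this
      obtain ⟨s, hs⟩ := Nat.exists_eq_succ_of_ne_zero hpos
      have h1 : p n (s + 1) = true := by
        have := Nat.find_spec hex
        rwa [hs] at this
      have h2 : p n s = false := by
        simpa [p] using Nat.find_min hex (m := s) (by omega)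
      exact ⟨Nat.pair n s, by simp [g, h1, h2]⟩
    · rintro ⟨i, hi⟩
      obtain ⟨h1, h2, -⟩ := hg1 i (by omega)
      obtain rfl : i.unpair.1 = n := by omega
      exact (hdom _).2 ⟨_, h2⟩
  · intro i j hi hij
    obtain ⟨hi1, hi2, hi3⟩ := hg1 i hi
    obtain ⟨hj1, hj2, hj3⟩ := hg1 j (hij ▸ hi)
    have h1 : i.unpair.1 = j.unpair.1 := by omega
    have h2 : i.unpair.2 = j.unpair.2 := by
      rw [← h1] at hj2 hj3
      rcases lt_trichotomy i.unpair.2 j.unpair.2 with h | h | h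
      · exact absurd (hmono _ _ _ h hi2) (by simpa [p] using hj3)
      · exact h
      · exact absurd (hmono _ _ _ h hj2) (by simpa [p] using hi3)
    rw [← Nat.pair_unpair i, ← Nat.pair_unpair j, h1, h2]

/-! ### Oracle programs -/

/-- Every partial recursive function is computed by an oracle program that makes no queries. -/
theorem OracleCode.exists_of_partrec {φ : ℕ →. ℕ} (hφ : Nat.Partrec φ) :
    ∃ c : OracleCode, ∀ (Y : Set ℕ) (n v : ℕ), v ∈ φ n → OracleCode.Run Y c n v ∅ := by
  induction hφ with
  | zero =>
    refine ⟨.zero, fun Y n v h => ?_⟩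
    obtain rfl : v = 0 := by simpa [pure, PFun.pure] using h
    exact .zero n
  | succ =>
    refine ⟨.succ, fun Y n v h => ?_⟩
    obtain rfl : v = n + 1 := by simpa using h
    exact .succ n
  | left =>
    refine ⟨.left, fun Y n v h => ?_⟩
    obtain rfl : v = n.unpair.1 := by simpa using h
    exact .left n
  | right =>
    refine ⟨.right, fun Y n v h => ?_⟩
    obtain rfl : v = n.unpair.2 := by simpa using h
    exact .right n
  | pair _ _ ih₁ ih₂ =>
    obtain ⟨a, ha⟩ := ih₁
    obtain ⟨b, hb⟩ := ih₂
    refine ⟨.pair a b, fun Y n v h => ?_⟩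
    simp only [Seq.seq, Part.map_eq_map, Part.mem_bind_iff, Part.mem_map_iff] at h
    obtain ⟨_, ⟨x, hx, rfl⟩, y, hy, rfl⟩ := h
    simpa using OracleCode.Run.pair (ha Y _ _ hx) (hb Y _ _ hy)
  | comp _ _ ih₁ ih₂ =>
    obtain ⟨a, ha⟩ := ih₁
    obtain ⟨b, hb⟩ := ih₂
    refine ⟨.comp a b, fun Y n v h => ?_⟩
    obtain ⟨x, hx, hv⟩ := Part.mem_bind_iff.1 h
    simpa using OracleCode.Run.comp (hb Y _ _ hx) (ha Y _ _ hv)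
  | prec _ _ ih₁ ih₂ =>
    obtain ⟨a, ha⟩ := ih₁
    obtain ⟨b, hb⟩ := ih₂
    refine ⟨.prec a b, fun Y n v h => ?_⟩
    obtain ⟨m, k, rfl⟩ : ∃ m k, n = Nat.pair m k := ⟨_, _, (Nat.pair_unpair n).symm⟩
    simp only [Nat.unpaired, Nat.unpair_pair] at h
    induction k generalizing v with
    | zero => exact .prec_zero (ha Y _ _ h)
    | succ k ih =>
      simp only [Part.bind_eq_bind, Part.mem_bind_iff] at h
      obtain ⟨i, hi, hv⟩ := h
      simpa using OracleCode.Run.prec_succ (ih i hi) (hb Y _ _ hv)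
  | rfind _ ih =>
    obtain ⟨a, ha⟩ := ih
    refine ⟨.comp (.rfind a) (.pair (.pair .left .right) .zero), fun Y n v h => ?_⟩
    obtain ⟨h0, hlt⟩ := Nat.mem_rfind.1 h
    have key : ∀ j ≤ v, OracleCode.Run Y (.rfind a) (Nat.pair n (v - j)) v ∅ := by
      intro j hj
      induction j with
      | zero =>
        obtain ⟨x, hx, hx0⟩ := (Part.mem_map_iff _).1 h0
        obtain rfl : x = 0 := by simpa using hx0
        exact OracleCode.Run.rfind_stop (ha Y _ _ hx)
      | succ j ih =>
        obtain ⟨x, hx, hx0⟩ := (Part.mem_map_iff _).1 (hlt (show v - (j + 1) < v by omega))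
        obtain ⟨x, rfl⟩ := Nat.exists_eq_succ_of_ne_zero (show x ≠ 0 by simpa using hx0)
        have h' := ih (by omega)
        rw [show v - j = v - (j + 1) + 1 by omega] at h'
        simpa using OracleCode.Run.rfind_next (ha Y _ _ hx) h'
    have hid : OracleCode.Run Y (.pair (.pair .left .right) .zero) n (Nat.pair n 0) ∅ := by
      simpa using (OracleCode.Run.pair (.pair (.left n) (.right n)) (.zero n) :
        OracleCode.Run Y _ n _ _)
    simpa using OracleCode.Run.comp hid (by simpa using key v le_rfl)

theorem OracleCode.exists_of_computable {g : ℕ → ℕ} (hg : Computable g) :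
    ∃ c : OracleCode, ∀ (Y : Set ℕ) (n : ℕ), OracleCode.Run Y c n (g n) ∅ := by
  obtain ⟨c, hc⟩ := OracleCode.exists_of_partrec (Partrec.nat_iff.1 hg.partrec)
  exact ⟨c, fun Y n => hc Y n _ (by simp)⟩

/-- An oracle program that reads the first `f n` digits of the oracle into the number `V (f n)`
whose binary representation they are, and then applies a partial recursive function to `n` and
this number. -/
theorem computableWithUse_of_partrec {X Y : Set ℕ} {f V : ℕ → ℕ} (hf : Computable f)
    (hV0 : V 0 = 0) (hV : ∀ k, V (k + 1) = 2 * V k + charFn Y k) {φ : ℕ →. ℕ} (hφ : Partrec φ)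
    (h : ∀ n, charFn X n ∈ φ (Nat.pair n (V (f n)))) : ComputableWithUse X Y f := by
  obtain ⟨cφ, hcφ⟩ := OracleCode.exists_of_partrec (Partrec.nat_iff.1 hφ)
  obtain ⟨cf, hcf⟩ := OracleCode.exists_of_computable (g := fun n => Nat.pair 0 (f n))
    (Primrec₂.natPair.to_comp.comp (Computable.const 0) hf)
  obtain ⟨cs, hcs⟩ := OracleCode.exists_of_computable
    (g := fun n => 2 * n.unpair.1 + n.unpair.2)
    (.nat_add (.nat_mul (.const 2) (Computable.fst.comp .unpair))
      (Computable.snd.comp .unpair))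
  -- On input `⟨0, ⟨k, i⟩⟩` the program `b` returns `2 * i + Y k`.
  let b : OracleCode := .comp cs (.pair (.comp .right .right)
    (.comp .oracle (.comp .left .right)))
  have hb : ∀ k i, OracleCode.Run Y b (Nat.pair 0 (Nat.pair k i)) (2 * i + charFn Y k) {k} := by
    intro k i
    have h1 : OracleCode.Run Y (.comp .right .right) (Nat.pair 0 (Nat.pair k i)) i ∅ := by
      simpa using (OracleCode.Run.comp (.right _) (.right _) :
        OracleCode.Run Y _ (Nat.pair 0 (Nat.pair k i)) _ _)
    have h2 : OracleCode.Run Y (.comp .left .right) (Nat.pair 0 (Nat.pair k i)) k ∅ := by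
      simpa using (OracleCode.Run.comp (.right _) (.left _) :
        OracleCode.Run Y _ (Nat.pair 0 (Nat.pair k i)) _ _)
    simpa using OracleCode.Run.comp (.pair h1 (.comp h2 (.oracle k))) (hcs Y _)
  have hloop : ∀ k, OracleCode.Run Y (.prec .zero b) (Nat.pair 0 k) (V k) (Finset.range k) := by
    intro k
    induction k with
    | zero => simpa [hV0] using (OracleCode.Run.prec_zero (.zero 0) :
        OracleCode.Run Y (.prec .zero b) _ _ _)
    | succ k ih =>
      rw [hV, Finset.range_add_one, Finset.insert_eq, Finset.union_comm]
      exact .prec_succ ih (hb k _)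
  refine ⟨.comp cφ (.pair (.pair .left .right) (.comp (.prec .zero b) cf)), fun n =>
    ⟨_, .comp (.pair (.pair (.left n) (.right n)) (.comp (hcf Y n) (hloop (f n))))
      (hcφ Y _ _ (by simpa using h n)), fun q hq => by simpa using hq⟩⟩

/-- The behaviour of an oracle program on finite oracles, as a partial recursive function: the
number `s` stands for the oracle whose `q`-th digit is the `q`-th binary digit of `s`, counted
from the least significant one. -/
theorem OracleCode.exists_partrec_of_finite_oracle (c : OracleCode) :
    ∃ φ : ℕ × ℕ →. ℕ, Partrec φ ∧ ∀ (Y : Set ℕ) (s n v : ℕ) (Q : Finset ℕ),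
      OracleCode.Run Y c n v Q → (∀ q ∈ Q, charFn Y q = s / 2 ^ q % 2) → v ∈ φ (s, n) := by
  induction c with
  | zero =>
    refine ⟨fun _ => Part.some 0, (Computable.const 0).partrec, fun Y s n v Q h _ => ?_⟩
    cases h; simp
  | succ =>
    refine ⟨fun p => Part.some (p.2 + 1), (Computable.succ.comp .snd).partrec,
      fun Y s n v Q h _ => ?_⟩
    cases h; simp
  | left =>
    refine ⟨fun p => Part.some p.2.unpair.1,
      (Computable.fst.comp (Computable.unpair.comp .snd)).partrec, fun Y s n v Q h _ => ?_⟩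
    cases h; simp
  | right =>
    refine ⟨fun p => Part.some p.2.unpair.2,
      (Computable.snd.comp (Computable.unpair.comp .snd)).partrec, fun Y s n v Q h _ => ?_⟩
    cases h; simp
  | oracle =>
    refine ⟨fun p => Part.some (p.1 / 2 ^ p.2 % 2),
      (Computable.nat_mod (.nat_div .fst (.two_pow .snd)) (.const 2)).partrec,
      fun Y s n v Q h hQ => ?_⟩
    cases h; simpa using hQ n
  | pair a b iha ihb =>
    obtain ⟨φ, hφ, ha⟩ := iha
    obtain ⟨ψ, hψ, hb⟩ := ihb
    refine ⟨fun p => (φ p).bind fun x => (ψ p).map fun y => Nat.pair x y,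
      hφ.bind ((hψ.comp .fst).map (Primrec₂.natPair.to_comp.comp (Computable.snd.comp .fst) .snd)),
      fun Y s n v Q h hQ => ?_⟩
    cases h with
    | pair h₁ h₂ =>
      exact Part.mem_bind (ha Y s _ _ _ h₁ fun q hq => hQ q (by simp [hq]))
        (Part.mem_map _ (hb Y s _ _ _ h₂ fun q hq => hQ q (by simp [hq])))
  | comp a b iha ihb =>
    obtain ⟨φ, hφ, ha⟩ := iha
    obtain ⟨ψ, hψ, hb⟩ := ihb
    refine ⟨fun p => (ψ p).bind fun x => φ (p.1, x),
      hψ.bind (hφ.comp ((Computable.fst.comp .fst).pair .snd)), fun Y s n v Q h hQ => ?_⟩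
    cases h with
    | comp h₁ h₂ =>
      exact Part.mem_bind (hb Y s _ _ _ h₁ fun q hq => hQ q (by simp [hq]))
        (ha Y s _ _ _ h₂ fun q hq => hQ q (by simp [hq]))
  | prec a b iha ihb =>
    obtain ⟨φ, hφ, ha⟩ := iha
    obtain ⟨ψ, hψ, hb⟩ := ihb
    let θ : ℕ × ℕ →. ℕ := fun p => p.2.unpair.2.rec (φ (p.1, p.2.unpair.1)) fun k IH =>
      IH.bind fun i => ψ (p.1, Nat.pair p.2.unpair.1 (Nat.pair k i))
    have hθ : Partrec θ := by
      have hu : Computable fun p : ℕ × ℕ => p.2.unpair.1 :=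
        Computable.fst.comp (Computable.unpair.comp .snd)
      refine Partrec.nat_rec (f := fun p : ℕ × ℕ => p.2.unpair.2)
        (h := fun p (y : ℕ × ℕ) => ψ (p.1, Nat.pair p.2.unpair.1 (Nat.pair y.1 y.2)))
        (Computable.snd.comp (Computable.unpair.comp .snd))
        (hφ.comp (Computable.fst.pair hu)) (hψ.comp ?_)
      exact (Computable.fst.comp .fst).pair (Primrec₂.natPair.to_comp.comp (hu.comp .fst)
        (Primrec₂.natPair.to_comp.comp (Computable.fst.comp .snd) (Computable.snd.comp .snd)))
    refine ⟨θ, hθ, fun Y s n v Q h hQ => ?_⟩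
    obtain ⟨m, k, rfl⟩ : ∃ m k, n = Nat.pair m k := ⟨_, _, (Nat.pair_unpair n).symm⟩
    induction k generalizing v Q with
    | zero =>
      generalize hn : Nat.pair m 0 = n at h
      cases h with
      | prec_zero h₁ =>
        obtain ⟨rfl, -⟩ := Nat.pair_eq_pair.1 hn
        simpa [θ] using ha Y s _ _ _ h₁ hQ
      | prec_succ h₁ h₂ => simp [Nat.pair_eq_pair] at hn
    | succ k ih =>
      generalize hn : Nat.pair m (k + 1) = n at h
      cases h with
      | prec_zero h₁ => simp [Nat.pair_eq_pair] at hn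
      | prec_succ h₁ h₂ =>
        obtain ⟨rfl, hk⟩ := Nat.pair_eq_pair.1 hn
        obtain rfl := Nat.succ_injective hk
        have h₃ := ih _ _ (fun q hq => hQ q (by simp [hq])) h₁
        have h₄ := hb Y s _ _ _ h₂ fun q hq => hQ q (by simp [hq])
        simp only [θ, Nat.unpair_pair] at h₃ ⊢
        exact Part.mem_bind h₃ h₄
  | rfind a iha =>
    obtain ⟨φ, hφ, ha⟩ := iha
    let arg : ℕ × ℕ → ℕ → ℕ × ℕ := fun p j =>
      (p.1, Nat.pair p.2.unpair.1 (p.2.unpair.2 + j))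
    have harg : Computable₂ arg :=
      (Computable.fst.comp .fst).pair (Primrec₂.natPair.to_comp.comp
        (Computable.fst.comp (Computable.unpair.comp (Computable.snd.comp .fst)))
        (.nat_add (Computable.snd.comp (Computable.unpair.comp (Computable.snd.comp .fst))) .snd))
    have hsearch : Partrec fun p : ℕ × ℕ =>
        Nat.rfind fun j => (φ (arg p j)).map fun x => decide (x = 0) :=
      Partrec.rfind ((hφ.comp harg).map (Computable.decide_eq .snd (.const 0)))
    refine ⟨fun p => (Nat.rfind fun j => (φ (arg p j)).map fun x => decide (x = 0)).map
        fun j => p.2.unpair.2 + j,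
      hsearch.map (.nat_add (Computable.snd.comp (Computable.unpair.comp
        (Computable.snd.comp .fst))) .snd), fun Y s n v Q h hQ => ?_⟩
    generalize hc : OracleCode.rfind a = c at h
    have hpos : ∃ j, v = n.unpair.2 + j ∧ true ∈ (φ (arg (s, n) j)).map (fun x => decide (x = 0)) ∧
        ∀ i < j, false ∈ (φ (arg (s, n) i)).map fun x => decide (x = 0) := by
      induction h with
      | rfind_stop h₁ _ =>
        cases hc
        exact ⟨0, by simp, by simpa [arg] using ha Y s _ _ _ h₁ hQ, by simp⟩
      | @rfind_next _ n m k x Q R h₁ _ _ ih =>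
        cases hc
        obtain ⟨j, hj, htrue, hfalse⟩ := ih (fun q hq => hQ q (by simp [hq])) rfl
        have h₃ := ha Y s _ _ _ h₁ fun q hq => hQ q (by simp [hq])
        have hshift : ∀ i, arg (s, Nat.pair n (m + 1)) i = arg (s, Nat.pair n m) (i + 1) := by
          intro i
          simp [arg, add_assoc, add_comm 1 i]
        simp only [hshift] at htrue hfalse
        refine ⟨j + 1, by simp only [Nat.unpair_pair] at hj ⊢; omega, htrue, ?_⟩
        rintro (_ | i) hi
        · exact (Part.mem_map_iff _).2 ⟨k + 1, by simpa [arg] using h₃, by simp⟩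
        · exact hfalse i (by omega)
      | _ => cases hc
    obtain ⟨j, rfl, htrue, hfalse⟩ := hpos
    exact Part.mem_map _ (Nat.mem_rfind.2 ⟨htrue, fun {i} hi => hfalse i hi⟩)

/-! ### Oracles from increasing approximations -/

/-- The exponent of the weight `2 ^ (-f n)` of the number `n` that `g` enumerates at stage `i`;
stages at which nothing is enumerated get the negligible weight `2 ^ (-i)`. -/
def stageExponent (f g : ℕ → ℕ) (i : ℕ) : ℕ := if g i = 0 then i else f (g i - 1)

theorem stageExponent_of_eq {f g : ℕ → ℕ} {i n : ℕ} (h : g i = n + 1) :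
    stageExponent f g i = f n := by
  simp [stageExponent, h]

theorem Computable.stageExponent {f g : ℕ → ℕ} (hf : Computable f) (hg : Computable g) :
    Computable (stageExponent f g) :=
  .ite' (.decide_eq hg (.const 0)) .id (hf.comp (.nat_sub hg (.const 1)))

theorem summable_two_pow_inv : Summable fun i : ℕ => ((2 : ℝ) ^ i)⁻¹ := by
  simpa using summable_geometric_two

theorem summable_stageExponent {f g : ℕ → ℕ} (hf : Summable fun n : ℕ => ((2 : ℝ) ^ f n)⁻¹)
    (hg : ∀ i j, g i ≠ 0 → g i = g j → i = j) :
    Summable fun i : ℕ => ((2 : ℝ) ^ stageExponent f g i)⁻¹ := by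
  have h1 : Summable ({i | g i = 0}.indicator fun i : ℕ => ((2 : ℝ) ^ i)⁻¹) :=
    summable_two_pow_inv.indicator _
  have h2 : Summable ({i | g i ≠ 0}.indicator fun i : ℕ => ((2 : ℝ) ^ f (g i - 1))⁻¹) := by
    rw [← summable_subtype_iff_indicator]
    refine hf.comp_injective (i := fun i : {i | g i ≠ 0} => g i - 1) fun i j hij => ?_
    have hi : g i ≠ 0 := i.2
    have hj : g j ≠ 0 := j.2
    exact Subtype.ext (hg _ _ hi (by simp only at hij; omega))
  refine (h1.add h2).congr fun i => ?_
  by_cases h : g i = 0 <;> simp [stageExponent, h]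

theorem floor_dyadic (a h k : ℕ) :
    ⌊(a : ℝ) / 2 ^ h * 2 ^ k⌋₊ = a * 2 ^ k / 2 ^ h := by
  rw [div_mul_eq_mul_div]
  exact_mod_cast Nat.floor_div_eq_div (K := ℝ) (a * 2 ^ k) (2 ^ h)

theorem floor_mul_two_pow_succ (x : ℝ) (k : ℕ) :
    ⌊x * 2 ^ (k + 1)⌋₊ / 2 = ⌊x * 2 ^ k⌋₊ := by
  rw [← Nat.floor_div_ofNat]
  congr 1
  rw [pow_succ]
  field_simp

/-- Let `V k` be the number formed by the first `k` digits of `Y`. Suppose that for every `k` there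
is a stage `t` at which `a t / 2 ^ h t` has the same first `k` digits as `Y`, and that if this
happens for `k = f n`, then `n` is not enumerated at stage `t + I` or later. Then `X` is computed by
searching for such a stage. -/
theorem computableWithUse_of_approximation {X Y : Set ℕ} {f g V a h : ℕ → ℕ} {I : ℕ}
    (hf : Computable f) (hg : Computable g) (hX : ∀ n, n ∈ X ↔ ∃ i, g i = n + 1)
    (ha : Computable a) (hh : Computable h)
    (hV0 : V 0 = 0) (hV : ∀ k, V (k + 1) = 2 * V k + charFn Y k)
    (hlim : ∀ k, ∃ t, ⌊(a t : ℝ) / 2 ^ h t * 2 ^ k⌋₊ = V k)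
    (henum : ∀ n i t, ⌊(a t : ℝ) / 2 ^ h t * 2 ^ f n⌋₊ = V (f n) → g i = n + 1 → i < t + I) :
    ComputableWithUse X Y f := by
  simp only [floor_dyadic] at hlim henum
  let φ : ℕ →. ℕ := fun p =>
    (Nat.rfind fun t => Part.some
      (decide (a t * 2 ^ f p.unpair.1 / 2 ^ h t = p.unpair.2))).map fun t =>
        min 1 (∑ i ∈ Finset.range (t + I), if g i = p.unpair.1 + 1 then 1 else 0)
  have hu1 : Computable fun p : ℕ => p.unpair.1 := Computable.fst.comp .unpair
  have hu2 : Computable fun p : ℕ => p.unpair.2 := Computable.snd.comp .unpair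
  have hφ : Partrec φ := by
    refine Partrec.map (Partrec.rfind ?_) ?_
    · exact (Computable.decide_eq (.nat_div (.nat_mul (ha.comp .snd)
        (.two_pow (hf.comp (hu1.comp .fst)))) (.two_pow (hh.comp .snd)))
        (hu2.comp .fst)).partrec
    · refine .nat_min (.const 1) (.sum_range (.nat_add .snd (.const I)) ?_)
      exact .ite' (.decide_eq (hg.comp .snd) (.nat_add (hu1.comp (Computable.fst.comp .fst))
        (.const 1))) (.const 1) (.const 0)
  refine computableWithUse_of_partrec hf hV0 hV hφ fun n => ?_
  have hdom : (Nat.rfind fun t => Part.some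
      (decide (a t * 2 ^ f n / 2 ^ h t = V (f n)))).Dom := by
    obtain ⟨t, ht⟩ := hlim (f n)
    exact Nat.rfind_dom.2 ⟨t, by simp [ht], by simp⟩
  obtain ⟨t, ht⟩ := Part.dom_iff_mem.1 hdom
  have ht' : a t * 2 ^ f n / 2 ^ h t = V (f n) := by
    simpa using Nat.rfind_spec ht
  refine (Part.mem_map_iff _).2 ⟨t, by simpa using ht, ?_⟩
  simp only [Nat.unpair_pair, Finset.sum_boole, Nat.cast_id]
  by_cases hn : n ∈ X
  · obtain ⟨i, hi⟩ := (hX n).1 hn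
    have : 0 < ((Finset.range (t + I)).filter fun i => g i = n + 1).card :=
      Finset.card_pos.2 ⟨i, by simp [hi, henum n i t ht' hi]⟩
    simp only [charFn, Set.indicator_of_mem hn]
    omega
  · have : ((Finset.range (t + I)).filter fun i => g i = n + 1) = ∅ :=
      Finset.filter_eq_empty_iff.2 fun i _ hi => hn ((hX n).2 ⟨i, hi⟩)
    simp [charFn, hn, this]

/-- If `∑ 2 ^ (-f n)` converges, then a computably enumerable set `X` is computable with use `f`
by the digits of `∑ 2 ^ (-f n)`, summed over almost all `n ∈ X`. -/
theorem exists_computableWithUse_of_summable {f : ℕ → ℕ} (hf : Computable f)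
    (hs : Summable fun n : ℕ => ((2 : ℝ) ^ f n)⁻¹) {X : Set ℕ} (hX : REPred fun n => n ∈ X) :
    ∃ Y : Set ℕ, ComputableWithUse X Y f := by
  obtain ⟨g, hg, hXg, hinj⟩ := hX.exists_enumeration
  have hsum := summable_stageExponent hs hinj
  obtain ⟨I, hI⟩ : ∃ I, ∑' j, ((2 : ℝ) ^ stageExponent f g (j + I))⁻¹ < 1 :=
    ((tendsto_sum_nat_add fun i => ((2 : ℝ) ^ stageExponent f g i)⁻¹).eventually_lt_const
      one_pos).exists
  let κ : ℕ → ℕ := fun j => stageExponent f g (j + I)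
  have hκ : Computable κ := (Computable.stageExponent hf hg).comp (.nat_add .id (.const I))
  let h : ℕ → ℕ := fun t => ∑ j ∈ Finset.range t, κ j
  let a : ℕ → ℕ := fun t => ∑ j ∈ Finset.range t, 2 ^ (h t - κ j)
  have hh : Computable h := .sum_range .id (hκ.comp .snd)
  have ha : Computable a :=
    .sum_range .id (.two_pow (.nat_sub (hh.comp .fst) (hκ.comp .snd)))
  let x : ℕ → ℝ := fun t => (a t : ℝ) / 2 ^ h t
  have hx : ∀ t, x t = ∑ j ∈ Finset.range t, ((2 : ℝ) ^ κ j)⁻¹ := by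
    intro t
    simp only [x, a, Nat.cast_sum, Nat.cast_pow, Nat.cast_ofNat, Finset.sum_div]
    refine Finset.sum_congr rfl fun j hj => ?_
    have hle : κ j ≤ h t := Finset.single_le_sum (fun _ _ => Nat.zero_le _) hj
    rw [pow_sub₀ _ two_ne_zero hle]
    field_simp
  have hx0 : ∀ t, 0 ≤ x t := fun t => by positivity
  have hx1 : ∀ t, x t < 1 := fun t => by
    rw [hx]
    exact (((summable_nat_add_iff I).2 hsum).sum_le_tsum _ fun _ _ => by positivity).trans_lt hI
  have hxmono : Monotone x := monotone_nat_of_le_succ fun t => by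
    simp only [hx, Finset.sum_range_succ]
    exact le_add_of_nonneg_right (by positivity)
  have hbdd : ∀ k, BddAbove (Set.range fun t => ⌊x t * 2 ^ k⌋₊) := by
    refine fun k => ⟨2 ^ k, ?_⟩
    rintro _ ⟨t, rfl⟩
    refine Nat.floor_le_of_le ?_
    push_cast
    exact mul_le_of_le_one_left (by positivity) (hx1 t).le
  -- The limits of the first `k` digits of `x t`; for dyadic `lim x t` they may differ from
  -- the digits of `lim x t`.
  let V : ℕ → ℕ := fun k => ⨆ t, ⌊x t * 2 ^ k⌋₊
  have hVle : ∀ t k, ⌊x t * 2 ^ k⌋₊ ≤ V k := fun t k => le_ciSup (hbdd k) t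
  have hVex : ∀ k, ∃ t, ⌊x t * 2 ^ k⌋₊ = V k := fun k =>
    Nat.sSup_mem (Set.range_nonempty _) (hbdd k)
  have hfloor : ∀ {s t : ℕ} (k : ℕ), s ≤ t → ⌊x s * 2 ^ k⌋₊ ≤ ⌊x t * 2 ^ k⌋₊ := fun k hst =>
    Nat.floor_mono (mul_le_mul_of_nonneg_right (hxmono hst) (by positivity))
  have hVhalf : ∀ k, V (k + 1) / 2 = V k := by
    intro k
    obtain ⟨s, hs⟩ := hVex k
    obtain ⟨t, ht⟩ := hVex (k + 1)
    have h1 : ⌊x (max s t) * 2 ^ k⌋₊ = V k :=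
      le_antisymm (hVle _ _) (hs ▸ hfloor k (le_max_left _ _))
    have h2 : ⌊x (max s t) * 2 ^ (k + 1)⌋₊ = V (k + 1) :=
      le_antisymm (hVle _ _) (ht ▸ hfloor _ (le_max_right _ _))
    rw [← h1, ← h2, floor_mul_two_pow_succ]
  refine ⟨{q | V (q + 1) % 2 = 1}, computableWithUse_of_approximation (V := V) (I := I) hf hg hXg
    ha hh ?_ (fun k => ?_) hVex fun n i t ht hi => ?_⟩
  · obtain ⟨t, ht⟩ := hVex 0
    rw [← ht, Nat.floor_eq_zero]
    simpa using hx1 t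
  · have := hVhalf k
    by_cases hk : V (k + 1) % 2 = 1
    · simp only [charFn, Set.indicator, Set.mem_ofPred_eq, hk, if_true]
      omega
    · simp only [charFn, Set.indicator, Set.mem_ofPred_eq, hk, if_false]
      omega
  · by_contra! hlt
    obtain ⟨j, rfl⟩ := Nat.exists_eq_add_of_le' (show I ≤ i by omega)
    have hstep : x t + ((2 : ℝ) ^ f n)⁻¹ ≤ x (j + 1) := by
      have h1 : x (j + 1) = x j + ((2 : ℝ) ^ f n)⁻¹ := by
        simp only [hx, Finset.sum_range_succ, κ, stageExponent_of_eq hi]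
      rw [h1]
      have := hxmono (show t ≤ j by omega)
      linarith
    have h2 : ⌊x t * 2 ^ f n⌋₊ + 1 ≤ ⌊x (j + 1) * 2 ^ f n⌋₊ := by
      rw [← Nat.floor_add_one (mul_nonneg (hx0 t) (by positivity))]
      refine Nat.floor_mono ?_
      have := mul_le_mul_of_nonneg_right hstep (show (0 : ℝ) ≤ 2 ^ f n by positivity)
      rwa [add_mul, inv_mul_cancel₀ (by positivity)] at this
    have := hVle (j + 1) (f n)
    change ⌊x t * 2 ^ f n⌋₊ = V (f n) at ht
    omega

/-! ### A diagonal set -/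

/-- Pairwise incompatible strings `F i`, of lengths `k i`, satisfy Kraft's inequality. Strings are
numbers, with the first digit the least significant one, so that the string `F i` extends `F j` if
`F i % 2 ^ k j = F j`. -/
theorem sum_two_pow_inv_le_one {k F : ℕ → ℕ} (hk : Monotone k) {m : ℕ}
    (hF : ∀ i < m + 1, F i < 2 ^ k i ∧ ∀ j < i, F i % 2 ^ k j ≠ F j) :
    ∑ i ∈ Finset.range (m + 1), ((2 : ℝ) ^ k i)⁻¹ ≤ 1 := by
  -- `S i` is the set of the extensions of `F i` to strings of the maximal length `k m`.
  let S : ℕ → Finset ℕ := fun i =>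
    (Finset.range (2 ^ (k m - k i))).image fun y => F i + 2 ^ k i * y
  have hS : ∀ i < m + 1, ∀ z ∈ S i, z < 2 ^ k m ∧ z % 2 ^ k i = F i := by
    intro i hi z hz
    obtain ⟨y, hy, rfl⟩ := Finset.mem_image.1 hz
    have hlt := (hF i hi).1
    rw [Finset.mem_range] at hy
    have hpow : 2 ^ k m = 2 ^ k i * 2 ^ (k m - k i) := by
      rw [← pow_add, Nat.add_sub_cancel' (hk (by omega))]
    refine ⟨?_, by simp [Nat.mod_eq_of_lt hlt]⟩
    calc F i + 2 ^ k i * y < 2 ^ k i + 2 ^ k i * y := by omega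
      _ = 2 ^ k i * (y + 1) := by ring
      _ ≤ _ := hpow ▸ Nat.mul_le_mul_left _ hy
  have hdisj : (Finset.range (m + 1) : Set ℕ).PairwiseDisjoint S := by
    have key : ∀ i < m + 1, ∀ j < i, Disjoint (S i) (S j) := by
      intro i hi j hj
      refine Finset.disjoint_left.2 fun z hzi hzj => (hF i hi).2 j hj ?_
      rw [← (hS i hi z hzi).2, ← (hS j (by omega) z hzj).2]
      exact Nat.mod_mod_of_dvd _ (pow_dvd_pow 2 (hk hj.le))
    intro i hi j hj hij
    simp only [Finset.coe_range, Set.mem_Iio] at hi hj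
    rcases lt_or_gt_of_ne hij with h | h
    · exact (key j hj i h).symm
    · exact key i hi j h
  have hcard : ∑ i ∈ Finset.range (m + 1), 2 ^ (k m - k i) ≤ 2 ^ k m := by
    calc ∑ i ∈ Finset.range (m + 1), 2 ^ (k m - k i)
        = ∑ i ∈ Finset.range (m + 1), (S i).card := by
          refine Finset.sum_congr rfl fun i _ => ?_
          rw [Finset.card_image_of_injective, Finset.card_range]
          intro y z hyz
          simpa using hyz
      _ = ((Finset.range (m + 1)).biUnion S).card := (Finset.card_biUnion hdisj).symm
      _ ≤ (Finset.range (2 ^ k m)).card := by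
          refine Finset.card_le_card (Finset.biUnion_subset.2 fun i hi z hz => ?_)
          exact Finset.mem_range.2 (hS i (Finset.mem_range.1 hi) z hz).1
      _ = 2 ^ k m := Finset.card_range _
  have hcard' : ∑ i ∈ Finset.range (m + 1), (2 : ℝ) ^ (k m - k i) ≤ 2 ^ k m := by
    exact_mod_cast hcard
  have hsum : ∑ i ∈ Finset.range (m + 1), (2 : ℝ) ^ (k m - k i) =
      2 ^ k m * ∑ i ∈ Finset.range (m + 1), ((2 : ℝ) ^ k i)⁻¹ := by
    rw [Finset.mul_sum]
    refine Finset.sum_congr rfl fun i hi => ?_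
    rw [pow_sub₀ _ two_ne_zero (hk (by have := Finset.mem_range.1 hi; omega))]
  rw [hsum] at hcard'
  exact le_of_mul_le_mul_left (by simpa using hcard') (show (0 : ℝ) < 2 ^ k m by positivity)

/-- The number, below `2 ^ k`, with binary digits `Y 0, …, Y (k - 1)`, starting from the least
significant one. -/
noncomputable def initialSegment (Y : Set ℕ) (k : ℕ) : ℕ :=
  ∑ q ∈ Finset.range k, charFn Y q * 2 ^ q

theorem charFn_le_one (Y : Set ℕ) (q : ℕ) : charFn Y q ≤ 1 := by
  by_cases h : q ∈ Y <;> simp [charFn, h]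

theorem initialSegment_lt (Y : Set ℕ) (k : ℕ) : initialSegment Y k < 2 ^ k := by
  induction k with
  | zero => simp [initialSegment]
  | succ k ih =>
    have h := Nat.mul_le_mul_right (2 ^ k) (charFn_le_one Y k)
    rw [initialSegment, Finset.sum_range_succ, ← initialSegment, pow_succ]
    omega

theorem initialSegment_mod (Y : Set ℕ) {k l : ℕ} (h : k ≤ l) :
    initialSegment Y l % 2 ^ k = initialSegment Y k := by
  induction l, h using Nat.le_induction with
  | base => exact Nat.mod_eq_of_lt (initialSegment_lt Y k)
  | succ l hl ih =>
    rw [initialSegment, Finset.sum_range_succ, ← initialSegment, Nat.add_mod, ih,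
      Nat.mod_eq_zero_of_dvd ((pow_dvd_pow 2 hl).mul_left _), add_zero,
      Nat.mod_eq_of_lt (initialSegment_lt Y k)]

theorem initialSegment_digit (Y : Set ℕ) {q k : ℕ} (h : q < k) :
    initialSegment Y k / 2 ^ q % 2 = charFn Y q := by
  rw [← Nat.mod_mul_right_div_self, ← pow_succ, initialSegment_mod Y h, initialSegment,
    Finset.sum_range_succ, ← initialSegment, Nat.add_mul_div_right _ _ (by positivity),
    Nat.div_eq_of_lt (initialSegment_lt Y q), zero_add]

/-- The `m`-th number of the `e`-th residue class, in a partition of the positive integers into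
infinitely many residue classes. -/
def classElem (e m : ℕ) : ℕ := 2 ^ e * (2 * m + 1)

theorem classElem_strictMono (e : ℕ) : StrictMono (classElem e) := fun i j hij =>
  Nat.mul_lt_mul_of_pos_left (by omega) (by positivity)

theorem classElem_injective {e m e' m' : ℕ} (h : classElem e m = classElem e' m') :
    e = e' ∧ m = m' := by
  have key : ∀ {e m e' m' : ℕ}, e < e' → classElem e m ≠ classElem e' m' := by
    intro e m e' m' hlt h
    obtain ⟨d, rfl⟩ := Nat.exists_eq_add_of_lt hlt
    rw [classElem, classElem, pow_succ, pow_add, mul_assoc, mul_assoc] at h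
    have := Nat.eq_of_mul_eq_mul_left (by positivity) h
    rw [Nat.mul_left_comm] at this
    omega
  rcases lt_trichotomy e e' with he | rfl | he
  · exact absurd h (key he)
  · exact ⟨rfl, (classElem_strictMono e).injective h⟩
  · exact absurd h.symm (key he)

theorem Computable.classElem {α : Type*} [Primcodable α] {f g : α → ℕ} (hf : Computable f)
    (hg : Computable g) : Computable fun a => classElem (f a) (g a) :=
  .nat_mul (.two_pow hf) (.nat_add (.nat_mul (.const 2) hg) (.const 1))

/-- `Refutes f e F i`: the string `F i` has length `f n`, where `n = classElem e i`, extends none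
of the strings `F j` with `j < i`, and makes the `e`-th partial recursive function take the value
`0` at `n`. Here a string is the number with these binary digits, the first one being the least
significant. -/
def Refutes (f : ℕ → ℕ) (e : ℕ) (F : ℕ → ℕ) (i : ℕ) : Prop :=
  F i < 2 ^ f (classElem e i) ∧
    0 ∈ (Denumerable.ofNat Nat.Partrec.Code e).eval (Nat.pair (F i) (classElem e i)) ∧
    ∀ j < i, F i % 2 ^ f (classElem e j) ≠ F j

/-- The diagonal set: `classElem e m` belongs to it if there are strings `F 0, …, F m` which, once
`classElem e 0, …, classElem e m` are in the set, can no longer be initial segments of an oracle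
from which the `e`-th partial recursive function computes the set. -/
def diagonalSet (f : ℕ → ℕ) : Set ℕ :=
  {n | ∃ e m, n = classElem e m ∧ ∃ F : ℕ → ℕ, ∀ i < m + 1, Refutes f e F i}

theorem classElem_mem_diagonalSet {f : ℕ → ℕ} {e m : ℕ} :
    classElem e m ∈ diagonalSet f ↔ ∃ F : ℕ → ℕ, ∀ i < m + 1, Refutes f e F i := by
  refine ⟨?_, fun h => ⟨e, m, rfl, h⟩⟩
  rintro ⟨e', m', h, hF⟩
  obtain ⟨rfl, rfl⟩ := classElem_injective h
  exact hF

/-- The `i`-th entry of the list of numbers with code `l`. -/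
def codedEntry (l i : ℕ) : ℕ := (Denumerable.ofNat (List ℕ) l).getD i 0

theorem codedEntry_encode_map (F : ℕ → ℕ) {m i : ℕ} (hi : i < m) :
    codedEntry (Encodable.encode ((List.range m).map F)) i = F i := by
  simp [codedEntry, List.getD, hi]

/-- The decidable version of `Refutes`, with a bound `t` on the number of steps, for the strings in
the list coded by `l`. -/
def RefutesIn (f : ℕ → ℕ) (e l t i : ℕ) : Prop :=
  codedEntry l i < 2 ^ f (classElem e i) ∧
    Nat.Partrec.Code.evaln t (Denumerable.ofNat Nat.Partrec.Code e)
      (Nat.pair (codedEntry l i) (classElem e i)) = some 0 ∧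
    ∀ j < i, ¬codedEntry l i % 2 ^ f (classElem e j) = codedEntry l j

instance (f : ℕ → ℕ) (e l t : ℕ) : DecidablePred (RefutesIn f e l t) := fun i =>
  inferInstanceAs (Decidable (_ ∧ _ ∧ ∀ j < i, ¬_))

theorem computable_refutesIn {α : Type*} [Primcodable α] {f : ℕ → ℕ} (hf : Computable f)
    {e l t i : α → ℕ} (he : Computable e) (hl : Computable l) (ht : Computable t)
    (hi : Computable i) :
    Computable fun a => decide (RefutesIn f (e a) (l a) (t a) (i a)) := by
  have hL : Computable₂ codedEntry :=
    (Primrec.list_getD 0).to_comp.comp ((Computable.ofNat (List ℕ)).comp .fst) .snd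
  have h1 : Computable fun a => decide (codedEntry (l a) (i a) < 2 ^ f (classElem (e a) (i a))) :=
    .decide_lt (hL.comp hl hi) (.two_pow (hf.comp (.classElem he hi)))
  have h2 : Computable fun a => decide (Nat.Partrec.Code.evaln (t a)
      (Denumerable.ofNat Nat.Partrec.Code (e a))
      (Nat.pair (codedEntry (l a) (i a)) (classElem (e a) (i a))) = some 0) :=
    .decide_eq (Nat.Partrec.Code.primrec_evaln.to_comp.comp
      ((ht.pair ((Computable.ofNat Nat.Partrec.Code).comp he)).pair
        (Primrec₂.natPair.to_comp.comp (hL.comp hl hi) (.classElem he hi)))) (.const (some 0))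
  have h3 : Computable fun a => decide (∀ j < i a,
      ¬codedEntry (l a) (i a) % 2 ^ f (classElem (e a) j) = codedEntry (l a) j) :=
    .decide_forall_lt hi (.decide_not (.decide_eq
      (.nat_mod ((hL.comp hl hi).comp .fst) (.two_pow (hf.comp (.classElem (he.comp .fst) .snd))))
      (hL.comp (hl.comp .fst) .snd)))
  exact (Computable.decide_and h1 (.decide_and h2 h3)).of_eq fun a => rfl

/-- `w = ⟨⟨e, m⟩, ⟨l, t⟩⟩` witnesses that `n = classElem e m` belongs to the diagonal set: the list
coded by `l` consists of the required strings, as is seen in `t` steps. -/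
def DiagonalWitness (f : ℕ → ℕ) (n w : ℕ) : Prop :=
  n = classElem w.unpair.1.unpair.1 w.unpair.1.unpair.2 ∧
    ∀ i < w.unpair.1.unpair.2 + 1,
      RefutesIn f w.unpair.1.unpair.1 w.unpair.2.unpair.1 w.unpair.2.unpair.2 i

instance (f : ℕ → ℕ) (n : ℕ) : DecidablePred (DiagonalWitness f n) := fun w =>
  inferInstanceAs (Decidable (_ ∧ ∀ i < w.unpair.1.unpair.2 + 1, RefutesIn f _ _ _ i))

theorem computable_diagonalWitness {f : ℕ → ℕ} (hf : Computable f) :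
    Computable fun x : ℕ × ℕ => decide (DiagonalWitness f x.1 x.2) := by
  have hu1 : Computable fun p : ℕ => p.unpair.1 := Computable.fst.comp .unpair
  have hu2 : Computable fun p : ℕ => p.unpair.2 := Computable.snd.comp .unpair
  have hw : Computable fun x : (ℕ × ℕ) × ℕ => x.1.2 := Computable.snd.comp .fst
  have h1 := Computable.decide_eq (Computable.fst (α := ℕ) (β := ℕ))
    (.classElem ((hu1.comp hu1).comp .snd) ((hu2.comp hu1).comp .snd))
  have h2 := computable_refutesIn hf ((hu1.comp hu1).comp hw) ((hu1.comp hu2).comp hw)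
    ((hu2.comp hu2).comp hw) (Computable.snd (α := ℕ × ℕ) (β := ℕ))
  have h3 := Computable.decide_forall_lt
    (p := fun (x : ℕ × ℕ) i =>
      RefutesIn f x.2.unpair.1.unpair.1 x.2.unpair.2.unpair.1 x.2.unpair.2.unpair.2 i)
    (.nat_add ((hu2.comp hu1).comp .snd) (.const 1)) h2
  exact (Computable.decide_and h1 h3).of_eq fun x => rfl

theorem rePred_diagonalSet {f : ℕ → ℕ} (hf : Computable f) :
    REPred fun n => n ∈ diagonalSet f := by
  refine (REPred.exists_of_computable (computable_diagonalWitness hf)).of_eq fun n => ⟨?_, ?_⟩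
  · rintro ⟨w, hn, hw⟩
    exact ⟨_, _, hn, codedEntry w.unpair.2.unpair.1, fun i hi =>
      ⟨(hw i hi).1, Nat.Partrec.Code.evaln_sound (hw i hi).2.1, (hw i hi).2.2⟩⟩
  · rintro ⟨e, m, hn, F, hF⟩
    have hex : ∀ i, ∃ k, i < m + 1 → 0 ∈ Nat.Partrec.Code.evaln k
        (Denumerable.ofNat Nat.Partrec.Code e) (Nat.pair (F i) (classElem e i)) := by
      intro i
      by_cases hi : i < m + 1
      · obtain ⟨k, hk⟩ := Nat.Partrec.Code.evaln_complete.1 (hF i hi).2.1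
        exact ⟨k, fun _ => hk⟩
      · exact ⟨0, fun h => absurd h hi⟩
    choose k hk using hex
    let t := ∑ i ∈ Finset.range (m + 1), k i
    refine ⟨Nat.pair (Nat.pair e m)
      (Nat.pair (Encodable.encode ((List.range (m + 1)).map F)) t), ?_⟩
    simp only [DiagonalWitness, Nat.unpair_pair]
    refine ⟨hn, fun i hi => ?_⟩
    rw [RefutesIn, codedEntry_encode_map F hi]
    refine ⟨(hF i hi).1, Nat.Partrec.Code.evaln_mono ?_ (hk i hi), fun j hj => ?_⟩
    · exact Finset.single_le_sum (fun _ _ => Nat.zero_le _) (Finset.mem_range.2 hi)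
    · rw [codedEntry_encode_map F (by omega)]
      exact (hF i hi).2.2 j hj

/-- If the diagonal set is computable with use `f` from any oracle, then `∑ 2 ^ (-f n)` converges:
for the class of numbers that deals with the program in question, the strings refuting the program
are never exhausted, and they are pairwise incompatible. -/
theorem summable_of_computableWithUse_diagonalSet {f : ℕ → ℕ} (hmono : Monotone f) {Y : Set ℕ}
    (h : ComputableWithUse (diagonalSet f) Y f) : Summable fun n : ℕ => ((2 : ℝ) ^ f n)⁻¹ := by
  obtain ⟨c, hc⟩ := h
  obtain ⟨φ, hφ, hφc⟩ := c.exists_partrec_of_finite_oracle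
  obtain ⟨code, hcode⟩ := Nat.Partrec.Code.exists_code.1
    (Partrec.nat_iff.1 (hφ.comp Computable.unpair))
  let e := Encodable.encode code
  have heval : ∀ s n, (Denumerable.ofNat Nat.Partrec.Code e).eval (Nat.pair s n) = φ (s, n) := by
    intro s n
    rw [Denumerable.ofNat_encode, hcode]
    exact congrArg φ (Nat.unpair_pair s n)
  have hY : ∀ n, charFn (diagonalSet f) n ∈ φ (initialSegment Y (f n), n) := by
    intro n
    obtain ⟨Q, hQ, hQf⟩ := hc n
    exact hφc Y _ _ _ Q hQ fun q hq => (initialSegment_digit Y (hQf q hq)).symm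
  have hne : ∀ F i, Refutes f e F i → classElem e i ∈ diagonalSet f →
      F i ≠ initialSegment Y (f (classElem e i)) := by
    intro F i hF hi heq
    have h0 := hF.2.1
    rw [heval, heq] at h0
    have := Part.mem_unique h0 (hY _)
    simp [charFn, hi] at this
  have hmem : ∀ m, classElem e m ∈ diagonalSet f := by
    intro m
    induction m using Nat.strong_induction_on with
    | _ m ih =>
      by_contra hm
      obtain ⟨F, hF⟩ : ∃ F : ℕ → ℕ, ∀ i < m, Refutes f e F i := by
        rcases m with _ | m
        · exact ⟨id, by simp⟩
        · exact classElem_mem_diagonalSet.1 (ih m (by omega))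
      refine hm (classElem_mem_diagonalSet.2
        ⟨Function.update F m (initialSegment Y (f (classElem e m))), fun i hi => ?_⟩)
      rcases Nat.lt_succ_iff_lt_or_eq.1 hi with hi | rfl
      · obtain ⟨h1, h2, h3⟩ := hF i hi
        simp only [Refutes, Function.update_of_ne hi.ne]
        exact ⟨h1, h2, fun j hj => by
          rw [Function.update_of_ne (by omega)]; exact h3 j hj⟩
      · simp only [Refutes, Function.update_self]
        refine ⟨initialSegment_lt _ _, ?_, fun j hj => ?_⟩
        · have := hY (classElem e i)
          rw [heval]
          simpa [charFn, hm] using this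
        · rw [Function.update_of_ne hj.ne,
            initialSegment_mod Y (hmono ((classElem_strictMono e).monotone hj.le))]
          exact (hne F j (hF j hj) (ih j hj)).symm
  have hbound : ∀ m, ∑ i ∈ Finset.range m, ((2 : ℝ) ^ f (classElem e i))⁻¹ ≤ 1 := by
    rintro (_ | m)
    · simp
    · obtain ⟨F, hF⟩ := classElem_mem_diagonalSet.1 (hmem m)
      exact sum_two_pow_inv_le_one (hmono.comp (classElem_strictMono e).monotone)
        fun i hi => ⟨(hF i hi).1, (hF i hi).2.2⟩
  have hsum : Summable fun i : ℕ => ((2 : ℝ) ^ f (classElem e i))⁻¹ :=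
    summable_of_sum_range_le (fun _ => by positivity) hbound
  have hanti : Antitone fun n : ℕ => ((2 : ℝ) ^ f n)⁻¹ := fun i j hij =>
    inv_anti₀ (by positivity) (pow_le_pow_right₀ one_le_two (hmono hij))
  rw [← summable_indicator_mod_iff hanti ((2 ^ e : ℕ) : ZMod (2 ^ (e + 1))),
    summable_indicator_mod_iff_summable]
  refine hsum.congr fun i => ?_
  rw [show classElem e i = 2 ^ (e + 1) * i + 2 ^ e by rw [classElem]; ring]

/-! ### Prefix-free codes -/

/-- The string consisting of the last `l` binary digits of `v`, the most significant one first. -/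
def binaryString (l v : ℕ) : List Bool := (List.range l).map fun i => v.testBit (l - 1 - i)

@[simp]
theorem length_binaryString (l v : ℕ) : (binaryString l v).length = l := by
  simp [binaryString]

theorem Computable.binaryString {α : Type*} [Primcodable α] {f g : α → ℕ} (hf : Computable f)
    (hg : Computable g) : Computable fun a => binaryString (f a) (g a) := by
  have h : Primrec fun p : ℕ × ℕ =>
      (List.range p.1).map fun i => decide (p.2 / 2 ^ (p.1 - 1 - i) % 2 = 1) := by
    refine Primrec.list_map (Primrec.list_range.comp .fst) ?_
    have hpow : Primrec fun n : ℕ => 2 ^ n :=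
      (Primrec.nat_rec₁ (f := fun _ m => m * 2) 1 (Primrec.nat_mul.comp .snd (.const 2))).of_eq fun n => by
        induction n with
        | zero => rfl
        | succ n ih => simp only [pow_succ, ← ih]
    exact Primrec.eq.decide.comp (Primrec.nat_mod.comp (Primrec.nat_div.comp
      (Primrec.snd.comp .fst) (hpow.comp (Primrec.nat_sub.comp (Primrec.nat_sub.comp
        (Primrec.fst.comp .fst) (.const 1)) .snd))) (.const 2)) (.const 1)
  refine (h.to_comp.comp (hf.pair hg)).of_eq fun a => ?_
  simp only [_root_.binaryString, Nat.testBit_eq_decide_div_mod_eq]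

/-- If one string is a prefix of another one, then the corresponding dyadic intervals are
contained in each other. -/
theorem le_and_lt_of_binaryString_prefix {l v l' v' : ℕ} (hv : v < 2 ^ l) (hv' : v' < 2 ^ l')
    (h : binaryString l v <+: binaryString l' v') :
    v * 2 ^ l' ≤ v' * 2 ^ l ∧ v' * 2 ^ l < (v + 1) * 2 ^ l' := by
  have hl : l ≤ l' := by simpa using h.length_le
  obtain ⟨d, rfl⟩ := Nat.exists_eq_add_of_le hl
  have hdiv : v = v' / 2 ^ d := by
    refine Nat.eq_of_testBit_eq fun j => ?_
    rw [Nat.testBit_div_two_pow]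
    by_cases hj : j < l
    · have h1 := h.getElem (i := l - 1 - j) (by simp; omega)
      simp only [binaryString, List.getElem_map, List.getElem_range] at h1
      rwa [show l - 1 - (l - 1 - j) = j by omega,
        show l + d - 1 - (l - 1 - j) = d + j by omega, add_comm] at h1
    · rw [Nat.testBit_lt_two_pow (hv.trans_le (pow_le_pow_right₀ one_le_two (by omega))),
        Nat.testBit_lt_two_pow (hv'.trans_le (pow_le_pow_right₀ one_le_two (by omega)))]
  have h1 : v * 2 ^ d ≤ v' := hdiv ▸ Nat.div_mul_le_self v' (2 ^ d)
  have h2 : v' < (v + 1) * 2 ^ d := by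
    rw [hdiv, mul_comm]; exact Nat.lt_mul_div_succ v' (by positivity)
  rw [pow_add]
  constructor
  · calc v * (2 ^ l * 2 ^ d) = v * 2 ^ d * 2 ^ l := by ring
      _ ≤ _ := Nat.mul_le_mul_right _ h1
  · calc v' * 2 ^ l < (v + 1) * 2 ^ d * 2 ^ l := Nat.mul_lt_mul_of_pos_right h2 (by positivity)
      _ = _ := by ring

/-- An effective form of the converse of Kraft's inequality: if the dyadic rationals
`q s = a s / 2 ^ h s` increase, then inside the disjoint intervals from `q s` to `q (s + 1)` one
finds dyadic intervals of at least a quarter of their lengths, that is, pairwise incompatible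
strings `τ s`. -/
theorem exists_prefixFree_code {a h : ℕ → ℕ} (ha : Computable a) (hh : Computable h)
    (hmono : StrictMono fun s => (a s : ℝ) / 2 ^ h s) (hle : ∀ s, (a s : ℝ) / 2 ^ h s ≤ 1) :
    ∃ τ : ℕ → List Bool, Computable τ ∧ (∀ s t, τ s <+: τ t → s = t) ∧
      ∀ s, (a (s + 1) : ℝ) / 2 ^ h (s + 1) - (a s : ℝ) / 2 ^ h s ≤
        4 * ((2 : ℝ) ^ (τ s).length)⁻¹ := by
  set q : ℕ → ℝ := fun s => (a s : ℝ) / 2 ^ h s with hq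
  let P : ℕ → ℕ → Prop := fun s l =>
    (a s * 2 ^ l / 2 ^ h s + 2) * 2 ^ h (s + 1) ≤ a (s + 1) * 2 ^ l
  let hPdec : DecidableRel P := fun s l => Nat.decLe _ _
  have hP : ∀ s l, P s l ↔ (⌊q s * 2 ^ l⌋₊ : ℝ) + 2 ≤ q (s + 1) * 2 ^ l := by
    intro s l
    rw [hq, floor_dyadic, div_mul_eq_mul_div, le_div_iff₀ (by positivity)]
    exact_mod_cast Iff.rfl
  have hPex : ∀ s, ∃ l, P s l := by
    intro s
    have hpos : 0 < q (s + 1) - q s := sub_pos.2 (hmono (Nat.lt_succ_self s))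
    obtain ⟨l, hl⟩ := pow_unbounded_of_one_lt (2 / (q (s + 1) - q s)) one_lt_two
    refine ⟨l, (hP s l).2 ?_⟩
    have h1 := Nat.floor_le (show 0 ≤ q s * 2 ^ l by positivity)
    rw [div_lt_iff₀ hpos] at hl
    linarith
  have hPcomp : ComputablePred fun p : ℕ × ℕ => P p.1 p.2 := by
    refine Computable.computablePred (p := fun p : ℕ × ℕ => P p.1 p.2) ?_
    have hs : Computable fun p : ℕ × ℕ => p.1 + 1 := Computable.succ.comp .fst
    exact .decide_le (.nat_mul (.nat_add (.nat_div (.nat_mul (ha.comp .fst) (.two_pow .snd))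
      (.two_pow (hh.comp .fst))) (.const 2)) (.two_pow (hh.comp hs)))
      (.nat_mul (ha.comp hs) (.two_pow .snd))
  let l : ℕ → ℕ := fun s => Nat.find (hPex s)
  let v : ℕ → ℕ := fun s => a s * 2 ^ l s / 2 ^ h s + 1
  have hl : Computable l := Computable.find hPcomp hPex
  have hv : Computable v :=
    .nat_add (.nat_div (.nat_mul ha (.two_pow hl)) (.two_pow hh)) (.const 1)
  have hvq : ∀ s, (v s : ℝ) = ⌊q s * 2 ^ l s⌋₊ + 1 := by
    intro s
    rw [hq, floor_dyadic]
    push_cast [v]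
    rfl
  have hlow : ∀ s, q s * 2 ^ l s < v s := fun s => by
    rw [hvq]; exact Nat.lt_floor_add_one _
  have hupp : ∀ s, (v s : ℝ) + 1 ≤ q (s + 1) * 2 ^ l s := fun s => by
    rw [hvq]
    have := (hP s (l s)).1 (Nat.find_spec (hPex s))
    linarith
  have hvlt : ∀ s, v s < 2 ^ l s := by
    intro s
    have h1 : q (s + 1) * 2 ^ l s ≤ 2 ^ l s := mul_le_of_le_one_left (by positivity) (hle _)
    have h2 : (v s : ℝ) < 2 ^ l s := by linarith [hupp s]
    exact_mod_cast h2
  have hkey : ∀ s t, s < t → ((v s : ℝ) + 1) * 2 ^ l t < v t * 2 ^ l s := by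
    intro s t hst
    have h1 : q (s + 1) ≤ q t := hmono.monotone hst
    calc ((v s : ℝ) + 1) * 2 ^ l t ≤ q (s + 1) * 2 ^ l s * 2 ^ l t := by gcongr; exact hupp s
      _ ≤ q t * 2 ^ l s * 2 ^ l t := by gcongr
      _ = q t * 2 ^ l t * 2 ^ l s := by ring
      _ < _ := by gcongr; exact hlow t
  refine ⟨fun s => binaryString (l s) (v s), .binaryString hl hv, fun s t hst => ?_, fun s => ?_⟩
  · obtain ⟨h1, h2⟩ := le_and_lt_of_binaryString_prefix (hvlt s) (hvlt t) hst
    rcases lt_trichotomy s t with hlt | rfl | hlt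
    · have := hkey s t hlt
      norm_cast at this
      omega
    · rfl
    · have := hkey t s hlt
      norm_cast at this
      rw [add_mul] at this
      omega
  · rw [length_binaryString]
    rcases hls : l s with _ | m
    · have h0 : (0 : ℝ) ≤ q s := by positivity
      have h1 : q (s + 1) ≤ 1 := hle _
      change q (s + 1) - q s ≤ _
      norm_num
      linarith
    · have hm : ¬P s m := Nat.find_min (hPex s) (show m < l s by omega)
      rw [hP, not_le] at hm
      have h1 := Nat.floor_le (show 0 ≤ q s * 2 ^ m by positivity)
      change q (s + 1) - q s ≤ _
      rw [pow_succ, ← div_eq_mul_inv, le_div_iff₀ (by positivity)]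
      linarith

/-! ### Kraft's inequality and the halting probability -/

theorem uniquelyDecodable_of_prefixFree {S : Set (List Bool)}
    (hS : ∀ σ ∈ S, ∀ τ ∈ S, σ <+: τ → σ = τ) (hnil : [] ∉ S) :
    InformationTheory.UniquelyDecodable S := by
  intro L₁
  induction L₁ with
  | nil =>
    rintro (_ | ⟨w, L₂⟩) - h₂ h
    · rfl
    · have : w = [] := (List.append_eq_nil_iff.1 h.symm).1
      exact absurd (this ▸ h₂ w (by simp)) hnil
  | cons w L₁ ih =>
    rintro (_ | ⟨w', L₂⟩) h₁ h₂ h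
    · have : w = [] := (List.append_eq_nil_iff.1 h).1
      exact absurd (this ▸ h₁ w (by simp)) hnil
    · simp only [List.flatten_cons] at h
      have hw : w ∈ S := h₁ w (by simp)
      have hw' : w' ∈ S := h₂ w' (by simp)
      have heq : w = w' := by
        rcases List.prefix_or_prefix_of_prefix (List.prefix_append w L₁.flatten)
          (h ▸ List.prefix_append w' L₂.flatten) with hp | hp
        · exact hS _ hw _ hw' hp
        · exact (hS _ hw' _ hw hp).symm
      subst heq
      rw [ih L₂ (fun x hx => h₁ x (by simp [hx])) (fun x hx => h₂ x (by simp [hx]))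
        (List.append_cancel_left h)]

/-- Kraft's inequality. -/
theorem sum_le_one_of_prefixFree {S : Finset (List Bool)}
    (hS : ∀ σ ∈ S, ∀ τ ∈ S, σ <+: τ → σ = τ) :
    ∑ σ ∈ S, ((2 : ℝ) ^ σ.length)⁻¹ ≤ 1 := by
  by_cases hnil : [] ∈ S
  · have : S = {[]} := Finset.eq_singleton_iff_unique_mem.2
      ⟨hnil, fun σ hσ => (hS _ hnil σ hσ List.nil_prefix).symm⟩
    simp [this]
  · simpa using InformationTheory.kraft_mcmillan_inequality
      (uniquelyDecodable_of_prefixFree (S := (S : Set (List Bool))) hS hnil)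

theorem IsPrefixFreeMachine.sum_le_one {U : List Bool →. List Bool} (hU : IsPrefixFreeMachine U)
    (S : Finset {σ : List Bool // (U σ).Dom}) :
    ∑ σ ∈ S, ((2 : ℝ) ^ σ.1.length)⁻¹ ≤ 1 := by
  have h := sum_le_one_of_prefixFree (S := S.map (Function.Embedding.subtype _)) (by
    simp only [Finset.mem_map, Function.Embedding.subtype_apply]
    rintro _ ⟨σ, -, rfl⟩ _ ⟨τ, -, rfl⟩ hp
    exact hU.prefix_free _ _ σ.2 τ.2 hp)
  rwa [Finset.sum_map] at h

theorem IsPrefixFreeMachine.summable {U : List Bool →. List Bool} (hU : IsPrefixFreeMachine U) :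
    Summable fun σ : {σ : List Bool // (U σ).Dom} => ((2 : ℝ) ^ σ.1.length)⁻¹ :=
  summable_of_sum_le (fun _ => by positivity) hU.sum_le_one

theorem IsPrefixFreeMachine.haltingProbability_le_one {U : List Bool →. List Bool}
    (hU : IsPrefixFreeMachine U) : haltingProbability U ≤ 1 :=
  hU.summable.tsum_le_of_sum_le hU.sum_le_one

/-- The domain of a prefix-free machine `U`, enumerated in finite stages `D s`: the weight of the
strings in `D s` is the computable dyadic rational `a s / 2 ^ s`, and the outputs of `U` on these
strings are shorter than `B s`. -/
theorem IsPrefixFreeMachine.exists_stages {U : List Bool →. List Bool}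
    (hU : IsPrefixFreeMachine U) :
    ∃ (D : ℕ → Finset {σ : List Bool // (U σ).Dom}) (a B : ℕ → ℕ), Computable a ∧ Computable B ∧
      StrictMono B ∧ Monotone D ∧ (∀ σ, ∃ s, σ ∈ D s) ∧
      (∀ s, (a s : ℝ) / 2 ^ s = ∑ σ ∈ D s, ((2 : ℝ) ^ σ.1.length)⁻¹) ∧
      ∀ s, ∀ σ ∈ D s, ∀ y ∈ U σ.1, y.length < B s := by
  obtain ⟨c, hc⟩ := Nat.Partrec.Code.exists_code.1 (Partrec.bind_decode₂_iff.1 hU.partrec)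
  have heval : ∀ m v, v ∈ Nat.Partrec.Code.eval c m ↔
      ∃ σ, Encodable.encode σ = m ∧ ∃ y ∈ U σ, Encodable.encode y = v := by
    intro m v
    rw [hc]
    simp only [Part.mem_bind_iff, Part.mem_map_iff, Part.mem_ofOption, Encodable.mem_decode₂]
  let H : ℕ → ℕ → Prop := fun s m => (Nat.Partrec.Code.evaln s c m).isSome = true
  let hH : ∀ s, DecidablePred (H s) := fun s m => instDecidableEqBool _ _
  have hinj : Function.Injective
      fun σ : {σ : List Bool // (U σ).Dom} => Encodable.encode σ.1 :=
    Encodable.encode_injective.comp Subtype.val_injective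
  let D : ℕ → Finset {σ : List Bool // (U σ).Dom} := fun s =>
    ((Finset.range s).filter (H s)).preimage (fun σ => Encodable.encode σ.1) hinj.injOn
  have hD : ∀ s σ, σ ∈ D s ↔ H s (Encodable.encode σ.1) := by
    intro s σ
    simp only [D, Finset.mem_preimage, Finset.mem_filter, Finset.mem_range, and_iff_right_iff_imp]
    intro h
    obtain ⟨v, hv⟩ := Option.isSome_iff_exists.1 h
    exact Nat.Partrec.Code.evaln_bound hv
  have hHdom : ∀ s m, H s m → ∃ σ : {σ : List Bool // (U σ).Dom}, Encodable.encode σ.1 = m := by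
    intro s m h
    obtain ⟨v, hv⟩ := Option.isSome_iff_exists.1 h
    obtain ⟨σ, hσ, y, hy, -⟩ := (heval m v).1 (Nat.Partrec.Code.evaln_sound hv)
    exact ⟨⟨σ, Part.dom_iff_mem.2 ⟨y, hy⟩⟩, hσ⟩
  let len : ℕ → ℕ := fun m => ((Encodable.decode m : Option (List Bool)).getD []).length
  have hlen : ∀ σ : List Bool, len (Encodable.encode σ) = σ.length := fun σ => by
    simp [len]
  have hlenc : Computable len :=
    Computable.list_length.comp (Computable.option_getD Computable.decode (.const []))
  have hevaln : Computable fun p : ℕ × ℕ => Nat.Partrec.Code.evaln p.1 c p.2 :=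
    Nat.Partrec.Code.primrec_evaln.to_comp.comp ((Computable.fst.pair (.const c)).pair .snd)
  let a : ℕ → ℕ := fun s => ∑ m ∈ Finset.range s, if H s m then 2 ^ (s - len m) else 0
  let C : ℕ → ℕ := fun s =>
    1 + ∑ m ∈ Finset.range s, (Nat.Partrec.Code.evaln s c m).getD 0
  let B : ℕ → ℕ := fun s => ∑ r ∈ Finset.range (s + 1), C r
  have hHc : Computable fun p : ℕ × ℕ => decide (H p.1 p.2) :=
    .decide_eq (Primrec.option_isSome.to_comp.comp hevaln) (.const true)
  have ha : Computable a := .sum_range .id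
    (.ite' hHc (.two_pow (.nat_sub .fst (hlenc.comp .snd))) (.const 0))
  have hC : Computable C := .nat_add (.const 1)
    (.sum_range .id (.option_getD hevaln (.const 0)))
  have hB : Computable B := .sum_range .succ (hC.comp .snd)
  refine ⟨D, a, B, ha, hB, strictMono_nat_of_lt_succ fun s => ?_, fun s t hst σ hσ => ?_,
    fun σ => ?_, fun s => ?_, fun s σ hσ y hy => ?_⟩
  · simp only [B]
    rw [Finset.sum_range_succ _ (s + 1)]
    simp only [C]
    omega
  · rw [hD] at hσ ⊢
    obtain ⟨v, hv⟩ := Option.isSome_iff_exists.1 hσ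
    exact Option.isSome_iff_exists.2 ⟨v, Nat.Partrec.Code.evaln_mono hst hv⟩
  · obtain ⟨y, hy⟩ := Part.dom_iff_mem.1 σ.2
    obtain ⟨s, hs⟩ := Nat.Partrec.Code.evaln_complete.1
      ((heval (Encodable.encode σ.1) _).2 ⟨σ.1, rfl, y, hy, rfl⟩)
    exact ⟨s, (hD s σ).2 (Option.isSome_iff_exists.2 ⟨_, hs⟩)⟩
  · have h1 : ∑ σ ∈ D s, ((2 : ℝ) ^ σ.1.length)⁻¹ =
        ∑ m ∈ (Finset.range s).filter (H s), ((2 : ℝ) ^ len m)⁻¹ := by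
      rw [← Finset.sum_preimage (fun σ : {σ : List Bool // (U σ).Dom} => Encodable.encode σ.1) _
        hinj.injOn (fun m => ((2 : ℝ) ^ len m)⁻¹)]
      · simp only [hlen, D]
      · intro m hm hrange
        exact absurd (hHdom s m (Finset.mem_filter.1 hm).2) hrange
    rw [h1, Finset.sum_filter]
    simp only [a, Nat.cast_sum, Finset.sum_div]
    refine Finset.sum_congr rfl fun m hm => ?_
    by_cases h : H s m
    · obtain ⟨σ, rfl⟩ := hHdom s m h
      have hle : σ.1.length ≤ s := (Encodable.length_le_encode σ.1).trans
        (Finset.mem_range.1 hm).le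
      rw [if_pos h, if_pos h, hlen]
      push_cast
      rw [pow_sub₀ _ two_ne_zero hle]
      field_simp
    · rw [if_neg h, if_neg h, Nat.cast_zero, zero_div]
  · obtain ⟨v, hv⟩ := Option.isSome_iff_exists.1 ((hD s σ).1 hσ)
    obtain ⟨σ', hσ', y', hy', rfl⟩ := (heval _ v).1 (Nat.Partrec.Code.evaln_sound hv)
    obtain rfl := Encodable.encode_injective hσ'
    obtain rfl := Part.mem_unique hy hy'
    have h1 : (Nat.Partrec.Code.evaln s c (Encodable.encode σ.1)).getD 0 ≤
        ∑ m ∈ Finset.range s, (Nat.Partrec.Code.evaln s c m).getD 0 :=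
      Finset.single_le_sum (f := fun m => (Nat.Partrec.Code.evaln s c m).getD 0)
        (fun _ _ => Nat.zero_le _) (Finset.mem_range.2 (Nat.Partrec.Code.evaln_bound hv))
    have h2 : C s ≤ B s := Finset.single_le_sum (f := C) (fun _ _ => Nat.zero_le _)
      (Finset.self_mem_range_succ s)
    have h3 := Encodable.length_le_encode y
    rw [Option.mem_def.1 hv, Option.getD_some] at h1
    simp only [C] at h2
    omega

/-! ### Approximations to the halting probability converge slowly -/

/-- The real `x` is the limit of the computable increasing sequence of the dyadic rationals
`a s / 2 ^ s`, and up to constant factors no computable bounded increasing sequence of dyadic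
rationals converges more slowly. -/
structure IsSlowestApproximation (a : ℕ → ℕ) (x : ℝ) : Prop where
  computable : Computable a
  monotone : Monotone fun s => (a s : ℝ) / 2 ^ s
  tendsto : Filter.Tendsto (fun s => (a s : ℝ) / 2 ^ s) Filter.atTop (nhds x)
  dominates : ∀ b h : ℕ → ℕ, Computable b → Computable h →
    Monotone (fun s => (b s : ℝ) / 2 ^ h s) → (∃ C : ℝ, ∀ s, (b s : ℝ) / 2 ^ h s ≤ C) →
    ∃ d : ℕ, ∀ s t, s ≤ t →
      (b t : ℝ) / 2 ^ h t - (b s : ℝ) / 2 ^ h s ≤ 2 ^ d * (x - (a s : ℝ) / 2 ^ s)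

/-- A prefix-free machine that outputs, on the code word for stage `s`, a string too long to have
been output by `U` so far. Thus `U` has to halt on some further string, which is at most a constant
longer than the code word. -/
theorem IsUniversalPrefixFreeMachine.exists_response {U : List Bool →. List Bool}
    (hU : IsUniversalPrefixFreeMachine U) {D : ℕ → Finset {σ : List Bool // (U σ).Dom}}
    {B : ℕ → ℕ} (hB : Computable B) (hBmono : StrictMono B) (hD : Monotone D)
    (hDB : ∀ s, ∀ σ ∈ D s, ∀ y ∈ U σ.1, y.length < B s)
    {τ : ℕ → List Bool} (hτ : Computable τ) (hτfree : ∀ s t, τ s <+: τ t → s = t) :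
    ∃ (d : ℕ) (ρ : ℕ → {σ : List Bool // (U σ).Dom}), Function.Injective ρ ∧
      (∀ s, (ρ s).1.length ≤ (τ s).length + d) ∧ ∀ s t, s ≤ t → ρ t ∉ D s := by
  let M : List Bool →. List Bool := fun σ =>
    (Nat.rfind fun s => Part.some (decide (τ s = σ))).map fun s =>
      (List.range (B s)).map fun _ => true
  have hM : IsPrefixFreeMachine M := by
    constructor
    · refine Partrec.map (Partrec.rfind ?_) ?_
      · exact (Computable.decide_eq (hτ.comp .snd) .fst).partrec
      · exact (Primrec.list_map Primrec.list_range (Primrec.const true).to₂).to_comp.comp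
          (hB.comp .snd)
    · have hdom : ∀ σ, (M σ).Dom → ∃ s, τ s = σ := by
        intro σ h
        obtain ⟨s, hs, -⟩ := Nat.rfind_dom.1 h
        exact ⟨s, by simpa using hs⟩
      intro σ σ' h h' hp
      obtain ⟨s, rfl⟩ := hdom σ h
      obtain ⟨t, rfl⟩ := hdom σ' h'
      rw [hτfree s t hp]
  obtain ⟨d, hd⟩ := hU.universal M hM
  have hMτ : ∀ s, ((List.range (B s)).map fun _ => true) ∈ M (τ s) := by
    intro s
    refine Part.mem_map _ (Nat.mem_rfind.2 ⟨by simp, fun {t} ht => ?_⟩)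
    have : τ t ≠ τ s := fun h => ht.ne (hτfree t s (h ▸ List.prefix_rfl))
    simpa using this
  choose ρ hρ hρlen using fun s => hd (τ s) _ (hMτ s)
  refine ⟨d, fun s => ⟨ρ s, Part.dom_iff_mem.2 ⟨_, hρ s⟩⟩, fun s t hst => ?_, hρlen,
    fun s t hst hmem => ?_⟩
  · have h1 : ρ s = ρ t := congrArg Subtype.val hst
    have h2 := congrArg List.length (Part.mem_unique (hρ s) (h1 ▸ hρ t))
    exact hBmono.injective (by simpa using h2)
  · simpa using hDB t _ (hD hst hmem) _ (hρ t)

/-- A bounded increasing sequence of dyadic rationals `β s` is turned into code words `τ s` of weight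
about `β (s + 1) - β s`; the strings on which `U` halts in response to those with index at least `s`
are missing in the approximation at stage `s`. -/
theorem IsUniversalPrefixFreeMachine.exists_isSlowestApproximation {U : List Bool →. List Bool}
    (hU : IsUniversalPrefixFreeMachine U) :
    ∃ a, IsSlowestApproximation a (haltingProbability U) := by
  obtain ⟨D, a, B, ha, hB, hBmono, hDmono, hDex, hDa, hDB⟩ :=
    hU.isPrefixFreeMachine.exists_stages
  have hsum := hU.isPrefixFreeMachine.summable
  refine ⟨a, ha, ?_, ?_, ?_⟩
  · intro s t hst
    simp only [hDa]
    exact Finset.sum_le_sum_of_subset_of_nonneg (hDmono hst) fun _ _ _ => by positivity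
  · simp only [hDa]
    exact hsum.hasSum.comp (Filter.tendsto_atTop_finset_of_monotone hDmono hDex)
  · intro b h hb hh hmono ⟨C, hC⟩
    set β : ℕ → ℝ := fun s => (b s : ℝ) / 2 ^ h s with hβ
    obtain ⟨N, hN⟩ := pow_unbounded_of_one_lt (max C 1) (one_lt_two (α := ℝ))
    -- Adding `1 - 2 ^ (-s)` makes the sequence strictly increasing.
    have hq : ∀ s, ((b s * 2 ^ s + (2 ^ s - 1) * 2 ^ h s : ℕ) : ℝ) / 2 ^ (h s + s + (N + 1)) =
        (β s + (1 - (2 ^ s)⁻¹)) / 2 ^ (N + 1) := by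
      intro s
      push_cast [hβ, Nat.one_le_two_pow]
      rw [pow_add, pow_add]
      field_simp
    have hpow : StrictAnti fun s : ℕ => ((2 : ℝ) ^ s)⁻¹ := fun s t hst =>
      inv_strictAnti₀ (by positivity) (pow_lt_pow_right₀ one_lt_two hst)
    obtain ⟨τ, hτ, hτfree, hτlen⟩ := exists_prefixFree_code
      (a := fun s => b s * 2 ^ s + (2 ^ s - 1) * 2 ^ h s) (h := fun s => h s + s + (N + 1))
      (.nat_add (.nat_mul hb (.two_pow .id))
        (.nat_mul (.nat_sub (.two_pow .id) (.const 1)) (.two_pow hh)))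
      (.nat_add (.nat_add hh .id) (.const (N + 1)))
      (by
        intro s t hst
        simp only [hq]
        have h1 : β s ≤ β t := hmono hst.le
        have h2 : ((2 : ℝ) ^ t)⁻¹ < (2 ^ s)⁻¹ := hpow hst
        exact div_lt_div_of_pos_right (by linarith) (by positivity))
      (by
        intro s
        rw [hq, div_le_one (by positivity), pow_succ]
        have h1 : β s ≤ C := hC s
        have h2 : (0 : ℝ) < (2 ^ s)⁻¹ := by positivity
        have h3 := le_max_left C 1
        have h4 := le_max_right C 1
        linarith)
    simp only [hq] at hτlen
    obtain ⟨d, ρ, hρinj, hρlen, hρD⟩ := hU.exists_response hB hBmono hDmono hDB hτ hτfree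
    refine ⟨d + 2 + (N + 1), fun s t hst => ?_⟩
    have h1 : ∑ σ ∈ D s ∪ (Finset.Ico s t).image ρ, ((2 : ℝ) ^ σ.1.length)⁻¹ ≤
        haltingProbability U := hsum.sum_le_tsum _ fun _ _ => by positivity
    have hdisj : Disjoint (D s) ((Finset.Ico s t).image ρ) := by
      refine Finset.disjoint_right.2 fun σ hσ => ?_
      obtain ⟨r, hr, rfl⟩ := Finset.mem_image.1 hσ
      exact hρD s r (Finset.mem_Ico.1 hr).1
    rw [Finset.sum_union hdisj, ← hDa, Finset.sum_image hρinj.injOn] at h1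
    have h2 : ∀ r, (β (r + 1) + (1 - (2 ^ (r + 1))⁻¹)) / 2 ^ (N + 1) -
        (β r + (1 - (2 ^ r)⁻¹)) / 2 ^ (N + 1) ≤ 2 ^ (d + 2) * ((2 : ℝ) ^ (ρ r).1.length)⁻¹ := by
      intro r
      refine (hτlen r).trans ?_
      have h3 : ((2 : ℝ) ^ ((τ r).length + d))⁻¹ ≤ (2 ^ (ρ r).1.length)⁻¹ :=
        inv_anti₀ (by positivity) (pow_le_pow_right₀ one_le_two (hρlen r))
      calc 4 * ((2 : ℝ) ^ (τ r).length)⁻¹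
          = 2 ^ (d + 2) * (2 ^ ((τ r).length + d))⁻¹ := by
            rw [pow_add, pow_add]; field_simp; norm_num
        _ ≤ _ := by gcongr
    have h4 := Finset.sum_le_sum fun r (_ : r ∈ Finset.Ico s t) => h2 r
    rw [Finset.sum_Ico_sub (fun r => (β r + (1 - ((2 : ℝ) ^ r)⁻¹)) / 2 ^ (N + 1)) hst,
      ← Finset.mul_sum, ← sub_div, div_le_iff₀ (by positivity)] at h4
    have h5 : ((2 : ℝ) ^ t)⁻¹ ≤ (2 ^ s)⁻¹ := hpow.antitone hst
    have h6 : (2 : ℝ) ^ (d + 2) * (∑ r ∈ Finset.Ico s t, ((2 : ℝ) ^ (ρ r).1.length)⁻¹) *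
        2 ^ (N + 1) ≤ 2 ^ (d + 2) * (haltingProbability U - a s / 2 ^ s) * 2 ^ (N + 1) := by
      gcongr
      linarith
    calc β t - β s ≤ 2 ^ (d + 2) * (haltingProbability U - a s / 2 ^ s) * 2 ^ (N + 1) := by
          linarith
      _ = _ := by rw [pow_add _ (d + 2)]; ring

/-! ### Solovay randomness -/

theorem Nat.cast_sub_eq_max (m n : ℕ) : ((m - n : ℕ) : ℝ) = max ((m : ℝ) - n) 0 := by
  rcases le_total n m with h | h
  · rw [Nat.cast_sub h, max_eq_left (sub_nonneg.2 (Nat.cast_le.2 h))]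
  · rw [Nat.sub_eq_zero_of_le h, Nat.cast_zero, max_eq_right (sub_nonpos.2 (Nat.cast_le.2 h))]

namespace IsSlowestApproximation

variable {a : ℕ → ℕ} {x : ℝ}

theorem le (hx : IsSlowestApproximation a x) (s : ℕ) : (a s : ℝ) / 2 ^ s ≤ x :=
  hx.monotone.ge_of_tendsto hx.tendsto s

theorem lt (hx : IsSlowestApproximation a x) (s : ℕ) : (a s : ℝ) / 2 ^ s < x := by
  have hq : ∀ s : ℕ, ((2 ^ s - 1 : ℕ) : ℝ) / 2 ^ s = 1 - (2 ^ s)⁻¹ := by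
    intro s
    push_cast [Nat.one_le_two_pow]
    field_simp
  have hpow : StrictAnti fun s : ℕ => ((2 : ℝ) ^ s)⁻¹ := fun s t hst =>
    inv_strictAnti₀ (by positivity) (pow_lt_pow_right₀ one_lt_two hst)
  obtain ⟨d, hd⟩ := hx.dominates (fun s => 2 ^ s - 1) id
    (.nat_sub (.two_pow .id) (.const 1)) .id
    (fun s t hst => by
      simp only [id, hq]
      linarith [hpow.antitone hst])
    ⟨1, fun s => by
      simp only [id, hq]
      linarith [show (0 : ℝ) < (2 ^ s)⁻¹ by positivity]⟩
  have h1 := hd s (s + 1) (Nat.le_succ s)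
  simp only [id, hq] at h1
  have h2 : ((2 : ℝ) ^ (s + 1))⁻¹ < (2 ^ s)⁻¹ := hpow (Nat.lt_succ_self s)
  by_contra! h3
  have h4 : 2 ^ d * (x - (a s : ℝ) / 2 ^ s) ≤ 0 :=
    mul_nonpos_of_nonneg_of_nonpos (by positivity) (by linarith)
  linarith

/-- A form of Solovay randomness of `x`: a summable computable sequence of lengths `2 ^ (-k i)`
reaches from the approximations `a (t i) / 2 ^ t i` beyond `x` only finitely often. Otherwise,
the sum over `i` of the part of the `i`-th of these intervals that lies to the left of the current
approximation would converge arbitrarily many times more slowly than the approximations. -/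
theorem exists_forall_add_lt (hx : IsSlowestApproximation a x) {t k : ℕ → ℕ} (ht : Computable t)
    (hk : Computable k) (hs : Summable fun i => ((2 : ℝ) ^ k i)⁻¹) :
    ∃ I, ∀ i, I ≤ i → (a (t i) : ℝ) / 2 ^ t i + (2 ^ k i)⁻¹ < x := by
  set α : ℕ → ℝ := fun s => (a s : ℝ) / 2 ^ s with hα
  let H : ℕ → ℕ := fun s => s + ∑ i ∈ Finset.range s, (t i + k i)
  let b : ℕ → ℕ := fun s => ∑ i ∈ Finset.range s,
    min (a s * 2 ^ (H s - s) - a (t i) * 2 ^ (H s - t i)) (2 ^ (H s - k i))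
  have hH : Computable H :=
    .nat_add .id (.sum_range .id (.nat_add (ht.comp .snd) (hk.comp .snd)))
  have ha := hx.computable
  have hb : Computable b := by
    refine .sum_range .id (.nat_min (.nat_sub ?_ ?_) ?_)
    · exact .nat_mul (ha.comp .fst) (.two_pow (.nat_sub (hH.comp .fst) .fst))
    · exact .nat_mul (ha.comp (ht.comp .snd)) (.two_pow (.nat_sub (hH.comp .fst) (ht.comp .snd)))
    · exact .two_pow (.nat_sub (hH.comp .fst) (hk.comp .snd))
  let part : ℕ → ℕ → ℝ := fun s i => min (max (α s - α (t i)) 0) (2 ^ k i)⁻¹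
  have hβ : ∀ s, (b s : ℝ) / 2 ^ H s = ∑ i ∈ Finset.range s, part s i := by
    intro s
    simp only [b, Nat.cast_sum, Finset.sum_div]
    refine Finset.sum_congr rfl fun i hi => ?_
    have hle : t i + k i ≤ ∑ i ∈ Finset.range s, (t i + k i) :=
      Finset.single_le_sum (f := fun i => t i + k i) (fun _ _ => Nat.zero_le _) hi
    have hpow : ∀ j ≤ H s, (2 : ℝ) ^ (H s - j) / 2 ^ H s = (2 ^ j)⁻¹ := by
      intro j hj
      rw [pow_sub₀ _ two_ne_zero hj]
      field_simp
    have h1 := hpow s (by simp only [H]; omega)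
    have h2 := hpow (t i) (by simp only [H]; omega)
    have h3 := hpow (k i) (by simp only [H]; omega)
    rw [Nat.cast_min, Nat.cast_sub_eq_max, ← min_div_div_right (by positivity),
      ← max_div_div_right (by positivity), sub_div]
    push_cast
    rw [mul_div_assoc, h1, mul_div_assoc, h2, h3, zero_div, ← div_eq_mul_inv, ← div_eq_mul_inv]
  have hpart0 : ∀ s i, 0 ≤ part s i := fun s i =>
    le_min (le_max_right _ _) (by positivity)
  have hpartmono : ∀ {s u : ℕ} (i : ℕ), s ≤ u → part s i ≤ part u i := fun i hsu =>
    min_le_min_right _ (max_le_max_right _ (sub_le_sub_right (hx.monotone hsu) _))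
  by_contra! hbad
  obtain ⟨d, hd⟩ := hx.dominates b H hb hH
    (fun s u hsu => by
      simp only [hβ]
      exact (Finset.sum_le_sum fun i _ => hpartmono i hsu).trans
        (Finset.sum_le_sum_of_subset_of_nonneg (Finset.range_subset_range.2 hsu)
          fun _ _ _ => hpart0 _ _))
    ⟨∑' i, ((2 : ℝ) ^ k i)⁻¹, fun s => by
      rw [hβ]
      exact (Finset.sum_le_sum fun i _ => min_le_right _ _).trans
        (hs.sum_le_tsum _ fun _ _ => by positivity)⟩
  have hinf : {i | x ≤ α (t i) + (2 ^ k i)⁻¹}.Infinite :=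
    Set.infinite_of_forall_exists_gt fun I => by
      obtain ⟨i, hi, h⟩ := hbad (I + 1)
      exact ⟨i, h, hi⟩
  obtain ⟨S, hS, hcard⟩ := hinf.exists_subset_card_eq (2 ^ d + 1)
  let s := ∑ i ∈ S, (i + 1 + t i)
  have hsS : ∀ i ∈ S, i + 1 + t i ≤ s := fun i hi =>
    Finset.single_le_sum (f := fun i => i + 1 + t i) (fun _ _ => Nat.zero_le _) hi
  -- From stage `s` on, the intervals with index in `S` all grow along with the approximations.
  have hgrow : ∀ u, s ≤ u → (2 ^ d + 1) * (α u - α s) ≤ 2 ^ d * (x - α s) := by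
    intro u hsu
    refine le_trans ?_ (hd s u hsu)
    have hpartS : ∀ v, s ≤ v → ∀ i ∈ S, part v i = α v - α (t i) := by
      intro v hv i hi
      have h1 : x ≤ α (t i) + (2 ^ k i)⁻¹ := hS hi
      have h2 : α (t i) ≤ α v := hx.monotone (by have := hsS i hi; omega)
      have h3 : α v ≤ x := hx.le v
      simp only [part]
      rw [max_eq_left (by linarith), min_eq_left (by linarith)]
    have hsub : S ⊆ Finset.range s := fun i hi =>
      Finset.mem_range.2 (by have := hsS i hi; omega)
    rw [hβ, hβ]
    calc (2 ^ d + 1) * (α u - α s) = ∑ i ∈ S, (part u i - part s i) := by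
          rw [Finset.sum_congr rfl fun i hi => show part u i - part s i = α u - α s by
            rw [hpartS u hsu i hi, hpartS s le_rfl i hi]; ring]
          rw [Finset.sum_const, hcard, nsmul_eq_mul]
          push_cast
          ring
      _ ≤ ∑ i ∈ Finset.range s, (part u i - part s i) :=
          Finset.sum_le_sum_of_subset_of_nonneg hsub fun i _ _ =>
            sub_nonneg.2 (hpartmono i hsu)
      _ = ∑ i ∈ Finset.range s, part u i - ∑ i ∈ Finset.range s, part s i :=
          Finset.sum_sub_distrib _ _
      _ ≤ _ := by
          gcongr
  have hlim : (2 ^ d + 1) * (x - α s) ≤ 2 ^ d * (x - α s) :=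
    le_of_tendsto ((hx.tendsto.sub_const (α s)).const_mul (2 ^ d + 1))
      (Filter.eventually_atTop.2 ⟨s, hgrow⟩)
  have hpos : α s < x := hx.lt s
  linarith

/-- If `x` were a dyadic rational, then stages at which the approximations are within `2 ^ (-i)` of
`x` could be computed from `i`, contrary to Solovay randomness. -/
theorem ne_dyadic (hx : IsSlowestApproximation a x) (p m : ℕ) : x ≠ (p : ℝ) / 2 ^ m := by
  intro hxp
  let P : ℕ → ℕ → Prop := fun i s =>
    p * 2 ^ s * 2 ^ i ≤ a s * 2 ^ m * 2 ^ i + 2 ^ m * 2 ^ s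
  let hPdec : DecidableRel P := fun i s => Nat.decLe _ _
  have hP : ∀ i s, P i s ↔ x ≤ (a s : ℝ) / 2 ^ s + (2 ^ i)⁻¹ := by
    intro i s
    have h1 : (a s : ℝ) / 2 ^ s + (2 ^ i)⁻¹ - x =
        (a s * 2 ^ m * 2 ^ i + 2 ^ m * 2 ^ s - p * 2 ^ s * 2 ^ i) / (2 ^ s * 2 ^ i * 2 ^ m) := by
      rw [hxp]
      field_simp
    rw [← sub_nonneg, h1, le_div_iff₀ (by positivity), zero_mul, sub_nonneg]
    exact_mod_cast Iff.rfl
  have hPex : ∀ i, ∃ s, P i s := by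
    intro i
    have hlt : x - (2 ^ i)⁻¹ < x := sub_lt_self _ (by positivity)
    obtain ⟨s, hs⟩ := (hx.tendsto.eventually_const_lt hlt).exists
    exact ⟨s, (hP i s).2 (by linarith)⟩
  have hPcomp : ComputablePred fun q : ℕ × ℕ => P q.1 q.2 := by
    refine Computable.computablePred (p := fun q : ℕ × ℕ => P q.1 q.2) ?_
    exact .decide_le
      (.nat_mul (.nat_mul (.const p) (.two_pow .snd)) (.two_pow .fst))
      (.nat_add (.nat_mul (.nat_mul (hx.computable.comp .snd) (.const (2 ^ m))) (.two_pow .fst))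
        (.nat_mul (.const (2 ^ m)) (.two_pow .snd)))
  obtain ⟨I, hI⟩ := hx.exists_forall_add_lt (Computable.find hPcomp hPex) .id
    summable_two_pow_inv
  exact absurd ((hP I _).1 (Nat.find_spec (hPex I))) (hI I le_rfl).not_ge

/-- If `∑ 2 ^ (-f n)` converges, then every computably enumerable set is computable from `x` with
use `f`: by Solovay randomness, for almost all `n`, the enumeration of `n` is followed by a change
of the first `f n` digits of the approximations. -/
theorem computableWithUse (hx : IsSlowestApproximation a x) (hx1 : x ≤ 1) {f : ℕ → ℕ}
    (hf : Computable f) (hs : Summable fun n : ℕ => ((2 : ℝ) ^ f n)⁻¹) {X : Set ℕ}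
    (hX : REPred fun n => n ∈ X) : ComputableWithUse X (binaryExpansion x) f := by
  obtain ⟨g, hg, hXg, hinj⟩ := hX.exists_enumeration
  obtain ⟨I, hI⟩ := hx.exists_forall_add_lt .id (Computable.stageExponent hf hg)
    (summable_stageExponent hs hinj)
  have ha0 : ∀ t, 0 ≤ (a t : ℝ) / 2 ^ t := fun t => by positivity
  have hx0 : 0 ≤ x := (ha0 0).trans (hx.le 0)
  have hx1' : x < 1 := lt_of_le_of_ne hx1 (by simpa using hx.ne_dyadic 1 0)
  refine computableWithUse_of_approximation (V := fun k => ⌊x * 2 ^ k⌋₊) (h := id) (I := I)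
    hf hg hXg hx.computable .id ?_ (fun k => ?_) (fun k => ?_) fun n i t ht hi => ?_
  · simpa [Nat.floor_eq_zero] using hx1'
  · have h1 := floor_mul_two_pow_succ x k
    have h2 : Real.digits x 2 k = 1 ↔ ⌊x * 2 ^ (k + 1)⌋₊ % 2 = 1 := by
      rw [Fin.ext_iff]
      simp [Real.digits]
    by_cases h3 : ⌊x * 2 ^ (k + 1)⌋₊ % 2 = 1
    · simp only [charFn, binaryExpansion, Set.indicator, Set.mem_ofPred_eq, h2, h3, if_true]
      omega
    · simp only [charFn, binaryExpansion, Set.indicator, Set.mem_ofPred_eq, h2, h3, if_false]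
      omega
  · have hlt : (⌊x * 2 ^ k⌋₊ : ℝ) / 2 ^ k < x := by
      refine lt_of_le_of_ne ?_ (hx.ne_dyadic _ k).symm
      rw [div_le_iff₀ (by positivity)]
      exact Nat.floor_le (by positivity)
    obtain ⟨t, ht⟩ := (hx.tendsto.eventually_const_lt hlt).exists
    refine ⟨t, le_antisymm (Nat.floor_mono ?_) (Nat.le_floor ?_)⟩
    · exact mul_le_mul_of_nonneg_right (hx.le t) (by positivity)
    · rw [div_lt_iff₀ (by positivity)] at ht
      exact ht.le
  · by_contra! hlt
    have h1 := hI i (by omega)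
    rw [stageExponent_of_eq hi] at h1
    have h2 := hx.monotone (show t ≤ i by omega)
    simp only [id] at ht h1 h2
    have h3 : ⌊(a t : ℝ) / 2 ^ t * 2 ^ f n⌋₊ + 1 ≤ ⌊x * 2 ^ f n⌋₊ := by
      rw [← Nat.floor_add_one (mul_nonneg (ha0 t) (by positivity))]
      refine Nat.floor_mono ?_
      have h4 := mul_le_mul_of_nonneg_right
        (show (a t : ℝ) / 2 ^ t + ((2 : ℝ) ^ f n)⁻¹ ≤ x by linarith)
        (show (0 : ℝ) ≤ 2 ^ f n by positivity)
      rwa [add_mul, inv_mul_cancel₀ (by positivity)] at h4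
    omega

end IsSlowestApproximation

theorem mainTheorem5 (f : ℕ → ℕ) (hf_mono : Monotone f) (hf_comp : Computable f) :
    (Summable (fun n : ℕ => ((2 : ℝ) ^ f n)⁻¹) ↔
      ∀ X : Set ℕ, REPred (fun n => n ∈ X) → ∃ Y : Set ℕ, ComputableWithUse X Y f) ∧
    ∀ U : List Bool →. List Bool, IsUniversalPrefixFreeMachine U →
      List.TFAE [
        Summable (fun n : ℕ => ((2 : ℝ) ^ f n)⁻¹),
        ∀ X : Set ℕ, REPred (fun n => n ∈ X) →
          ComputableWithUse X (binaryExpansion (haltingProbability U)) f,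
        ∀ X : Set ℕ, REPred (fun n => n ∈ X) → ∃ Y : Set ℕ, ComputableWithUse X Y f] := by
  have hca : (∀ X : Set ℕ, REPred (fun n => n ∈ X) → ∃ Y : Set ℕ, ComputableWithUse X Y f) →
      Summable (fun n : ℕ => ((2 : ℝ) ^ f n)⁻¹) := fun h => by
    obtain ⟨Y, hY⟩ := h (diagonalSet f) (rePred_diagonalSet hf_comp)
    exact summable_of_computableWithUse_diagonalSet hf_mono hY
  refine ⟨⟨fun hs X hX => exists_computableWithUse_of_summable hf_comp hs hX, hca⟩,
    fun U hU => ?_⟩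
  tfae_have 1 → 2 := fun hs X hX => by
    obtain ⟨a, ha⟩ := hU.exists_isSlowestApproximation
    exact ha.computableWithUse hU.isPrefixFreeMachine.haltingProbability_le_one hf_comp hs hX
  tfae_have 2 → 3 := fun h X hX => ⟨_, h X hX⟩
  tfae_have 3 → 1 := hca
  tfae_finish
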